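/- Let $\mathbb{F}_2=\langle \mathtt a,\mathtt b\rangle$ be the free group on two generators and let $\mathcal A\subset\mathbb{F}_2$ be the set of alternating words, i.e. of those elements whose reduced words alternate between letters in $\{\mathtt a,\mathtt a^{-1}\}$ and letters in $\{\mathtt b,\mathtt b^{-1}\}$. For a group $G$, a map $\Phi\colon G\to\mathcal A$ is called a letter-quasimorphism if $\Phi(g^{-1})=\Phi(g)^{-1}$ for all $g\in G$ and if for all $g,h\in G$ one of the following holds: 1. $\Phi(g)\Phi(h)\Phi(gh)^{-1}=e$; or 2. there are $c_1,c_2,c_3\in\mathcal A$ and letters $\mathtt x_1,\mathtt x_2,\mathtt x_3$ such that either $\mathtt x_1,\mathtt x_2,\mathtt x_3,\ \mathtt x_1\mathtt x_2\mathtt x_3\in\{\mathtt a,\mathtt a^{-1}\}$ or $\mathtt x_1,\mathtt x_2,\mathtt x_3,\ \mathtt x_1\mathtt x_2\mathtt x_3\in\{\mathtt b,\mathtt b^{-1}\}$, and such that $\Phi(g)=c_1^{-1}\mathtt x_1c_2$, $\Phi(h)=c_2^{-1}\mathtt x_2c_3$ and $\Phi(gh)^{-1}=c_3^{-1}\mathtt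 x_3c_1$ as freely reduced alternating words. A quasimorphism on $G$ is a map $\phi\colon G\to\mathbb{R}$ for which there is a constant $D$ with $|\phi(g)+\phi(h)-\phi(gh)|\le D$ for all $g,h\in G$; the infimum of all such $D$ is its defect $D(\phi)$. It is homogeneous if $\phi(g^n)=n\phi(g)$ for all $g\in G$, $n\in\mathbb{Z}$. For $g$ in the commutator subgroup $G'$, $\mathrm{cl}(g)$ is the least number of commutators whose product is $g$, and $\mathrm{scl}(g)=\lim_{n\to\infty}\mathrm{cl}(g^n)/n$. The real bounded Euler class $\mathrm{eu}_b^{\mathbb R}\in \mathrm H^2_b(\mathrm{Homeo}^+(S^1),\mathbb{R})$ is the image of the class of the integral bounded cocycle $\omega_b(f,g)=\sigma_b(f)\sigma_b(g)\sigma_b(fg)^{-1}\in\mathbb{Z}$, where $S^1=\mathbb{R}/\mathbb{Z}$, $\sigma_b(f)$ is the unique lift of $f$ to an orientation preserving homeomorphism of $\mathbb{R}$ commuting with integer translations with $\sigma_b(f)(0)\in[0,1)$, and $n\in\mathbb{Z}$ is identified with $x\mapsto x+n$. **Theorem.** Let $G$ be a group, let $g_0\in G$ and let $\Phi\colon G\to\mathcal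 A$ be a letter-quasimorphism such that $\Phi(g_0)$ is non-trivial and $\Phi(g_0^n)=\Phi(g_0)^n$ for all $n\in\mathbb{N}$. Then there is a homogeneous quasimorphism $\bar\phi\colon G\to\mathbb{R}$ with $D(\bar\phi)\le 1$ and $\bar\phi(g_0)\ge 1$ such that moreover, if $G$ is countable, there is an action $\rho\colon G\to\mathrm{Homeo}^+(S^1)$ with $[\delta^1\bar\phi]=\rho^*\mathrm{eu}_b^{\mathbb R}\in \mathrm H_b^2(G,\mathbb{R})$. If $g_0\in G'$, then $\mathrm{scl}(g_0)\ge 1/2$. -/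

import Mathlib

namespace LetterQM

/-! ### Alternating words and letter-quasimorphisms -/

/-- The free group on two generators; `0 : Fin 2` stands for the generator `a`, `1` for `b`.
The reduced word of `w` is `w.toWord : List (Fin 2 × Bool)`, where `(i, true)` is the `i`-th
generator and `(i, false)` its inverse. -/
abbrev F2 : Type := FreeGroup (Fin 2)

/-- The set of alternating words: in the reduced word, powers of `a` and powers of `b` alternate. -/
def altWords : Set F2 :=
  {w | w.toWord.IsChain (fun x y => x.1 ≠ y.1)}

/-- The element of the free group given by a single letter. -/
def letter (x : Fin 2 × Bool) : F2 := FreeGroup.mk [x]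

/-- `w = c⁻¹ x d`, where the right hand side is a reduced word without cancellation. -/
def IsReducedProduct (w c : F2) (x : Fin 2 × Bool) (d : F2) : Prop :=
  w.toWord = (c⁻¹).toWord ++ [x] ++ d.toWord

/-- Letter-quasimorphisms from `G` to the set of alternating words. -/
structure IsLetterQuasimorphism {G : Type*} [Group G] (Φ : G → F2) : Prop where
  mem_altWords : ∀ g, Φ g ∈ altWords
  map_inv : ∀ g, Φ g⁻¹ = (Φ g)⁻¹
  thin : ∀ g h, Φ g * Φ h * (Φ (g * h))⁻¹ = 1 ∨
    ∃ c₁ ∈ altWords, ∃ c₂ ∈ altWords, ∃ c₃ ∈ altWords,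
      ∃ (i : Fin 2) (ε₁ ε₂ ε₃ : Bool),
        (letter (i, ε₁) * letter (i, ε₂) * letter (i, ε₃) = letter (i, true) ∨
          letter (i, ε₁) * letter (i, ε₂) * letter (i, ε₃) = letter (i, false)) ∧
        IsReducedProduct (Φ g) c₁ (i, ε₁) c₂ ∧
        IsReducedProduct (Φ h) c₂ (i, ε₂) c₃ ∧
        IsReducedProduct (Φ (g * h))⁻¹ c₃ (i, ε₃) c₁

/-! ### Quasimorphisms -/

section Quasimorphisms

variable {G : Type*} [Group G]

/-- `φ` is a quasimorphism. -/
def IsQuasimorphism (φ : G → ℝ) : Prop :=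
  ∃ D : ℝ, ∀ g h, |φ g + φ h - φ (g * h)| ≤ D

/-- The defect: the infimum of all admissible constants. -/
noncomputable def defect (φ : G → ℝ) : ℝ :=
  sInf {D : ℝ | ∀ g h, |φ g + φ h - φ (g * h)| ≤ D}

/-- `φ (g ^ n) = n * φ g` for all integers `n`. -/
def IsHomogeneous (φ : G → ℝ) : Prop :=
  ∀ (g : G) (n : ℤ), φ (g ^ n) = n * φ g

end Quasimorphisms

/-! ### Stable commutator length -/

section Scl

variable {G : Type*} [Group G]

/-- The numbers `k` such that `g` is a product of `k` commutators. -/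
def commLengths (g : G) : Set ℕ :=
  {k | ∃ l : List (G × G), l.length = k ∧ (l.map fun p => p.1 * p.2 * p.1⁻¹ * p.2⁻¹).prod = g}

/-- Commutator length (meaningful on the commutator subgroup). -/
noncomputable def cl (g : G) : ℕ := sInf (commLengths g)

/-- Stable commutator length, `lim cl (g ^ n) / n` (meaningful on the commutator subgroup,
where the limit exists by `tendsto_scl`). -/
noncomputable def scl (g : G) : ℝ :=
  Filter.atTop.limUnder (fun n : ℕ => (cl (g ^ n) : ℝ) / n)

theorem commLengths_mul {g h : G} {k l : ℕ} (hk : k ∈ commLengths g) (hl : l ∈ commLengths h) :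
    k + l ∈ commLengths (g * h) := by
  obtain ⟨u, rfl, rfl⟩ := hk
  obtain ⟨v, rfl, rfl⟩ := hl
  exact ⟨u ++ v, by simp, by simp⟩

theorem commLengths_inv {g : G} {k : ℕ} (hk : k ∈ commLengths g) : k ∈ commLengths g⁻¹ := by
  obtain ⟨u, rfl, rfl⟩ := hk
  refine ⟨(u.map Prod.swap).reverse, by simp, ?_⟩
  induction u with
  | nil => simp
  | cons p u ih => simp_all [mul_assoc]

theorem commLengths_nonempty {g : G} (hg : g ∈ commutator G) : (commLengths g).Nonempty := by
  rw [commutator_eq_closure] at hg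
  induction hg using Subgroup.closure_induction with
  | mem x hx =>
    obtain ⟨a, b, rfl⟩ := hx
    exact ⟨1, [(a, b)], by simp, by simp [commutatorElement_def]⟩
  | one => exact ⟨0, [], by simp, by simp⟩
  | mul x y _ _ hx hy => exact ⟨_, commLengths_mul hx.choose_spec hy.choose_spec⟩
  | inv x _ hx => exact ⟨_, commLengths_inv hx.choose_spec⟩

theorem cl_mul_le {g h : G} (hg : g ∈ commutator G) (hh : h ∈ commutator G) :
    cl (g * h) ≤ cl g + cl h :=
  Nat.sInf_le (commLengths_mul (Nat.sInf_mem (commLengths_nonempty hg))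
    (Nat.sInf_mem (commLengths_nonempty hh)))

/-- On the commutator subgroup the limit defining `scl` exists. -/
theorem tendsto_scl {g : G} (hg : g ∈ commutator G) :
    Filter.Tendsto (fun n : ℕ => (cl (g ^ n) : ℝ) / n) Filter.atTop (nhds (scl g)) := by
  have hsub : Subadditive (fun n : ℕ => (cl (g ^ n) : ℝ)) := by
    intro m n
    change (cl (g ^ (m + n)) : ℝ) ≤ cl (g ^ m) + cl (g ^ n)
    rw [pow_add]
    exact_mod_cast cl_mul_le (pow_mem hg m) (pow_mem hg n)
  refine tendsto_nhds_limUnder ⟨_, hsub.tendsto_lim ⟨0, ?_⟩⟩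
  rintro _ ⟨n, rfl⟩
  positivity

end Scl

/-! ### Second bounded cohomology (inhomogeneous cochains, trivial coefficients) -/

section BoundedCohomology

variable (G H : Type*) [Group G] [Group H] (V W : Type*) [NormedAddCommGroup V]
  [NormedAddCommGroup W]

/-- The coboundary in degree one. -/
def coboundary1 : (G → V) →+ (G × G → V) where
  toFun f := fun p => f p.2 - f (p.1 * p.2) + f p.1
  map_zero' := by ext; simp
  map_add' f f' := by ext; simp; abel

/-- The coboundary in degree two. -/
def coboundary2 : (G × G → V) →+ (G × G × G → V) where
  toFun f := fun p =>
    f (p.2.1, p.2.2) - f (p.1 * p.2.1, p.2.2) + f (p.1, p.2.1 * p.2.2) - f (p.1, p.2.1)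
  map_zero' := by ext; simp
  map_add' f f' := by ext; simp; abel

/-- Bounded functions on a set `X`. -/
def boundedFun (X : Type*) : AddSubgroup (X → V) where
  carrier := {f | ∃ C : ℝ, ∀ x, ‖f x‖ ≤ C}
  zero_mem' := ⟨0, by simp⟩
  add_mem' := by
    rintro f f' ⟨C, hC⟩ ⟨C', hC'⟩
    exact ⟨C + C', fun x => (norm_add_le _ _).trans (add_le_add (hC x) (hC' x))⟩
  neg_mem' := by
    rintro f ⟨C, hC⟩
    exact ⟨C, by simpa using hC⟩

/-- Bounded 2-cocycles. -/
def boundedCocycles : AddSubgroup (G × G → V) :=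
  boundedFun V (G × G) ⊓ (coboundary2 G V).ker

/-- Coboundaries of bounded 1-cochains. -/
def boundedCoboundaries : AddSubgroup (G × G → V) :=
  (boundedFun V G).map (coboundary1 G V)

variable {G V} in
theorem coboundary2_coboundary1 (f : G → V) : coboundary2 G V (coboundary1 G V f) = 0 := by
  ext p
  simp [coboundary1, coboundary2, mul_assoc]
  abel

theorem boundedCoboundaries_le : boundedCoboundaries G V ≤ boundedCocycles G V := by
  rintro _ ⟨f, ⟨C, hC⟩, rfl⟩
  refine ⟨⟨C + C + C, fun p => ?_⟩, coboundary2_coboundary1 f⟩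
  exact (norm_add_le _ _).trans
    (add_le_add ((norm_sub_le _ _).trans (add_le_add (hC _) (hC _))) (hC _))

/-- The second bounded cohomology group of `G` with coefficients in `V`. -/
abbrev H2b : Type _ :=
  boundedCocycles G V ⧸ (boundedCoboundaries G V).addSubgroupOf (boundedCocycles G V)

variable {G H V W}

/-- The class of a bounded cocycle. -/
def H2b.mk (f : boundedCocycles G V) : H2b G V := QuotientAddGroup.mk f

/-- Pulling back bounded cocycles along a homomorphism. -/
def pullbackCocycle (ρ : G →* H) : boundedCocycles H V →+ boundedCocycles G V where
  toFun f := ⟨fun p => f.1 (ρ p.1, ρ p.2), by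
    obtain ⟨C, hC⟩ := f.2.1
    refine ⟨⟨C, fun p => hC _⟩, ?_⟩
    have h : coboundary2 H V f.1 = 0 := f.2.2
    change coboundary2 G V _ = 0
    ext p
    simpa [coboundary2] using congrFun h (ρ p.1, ρ p.2.1, ρ p.2.2)⟩
  map_zero' := rfl
  map_add' _ _ := rfl

/-- The map `ρ^*` induced on second bounded cohomology by a homomorphism `ρ`. -/
def H2b.pullback (ρ : G →* H) : H2b H V →+ H2b G V :=
  QuotientAddGroup.map _ _ (pullbackCocycle ρ) (by
    rintro f ⟨b, ⟨C, hC⟩, hb⟩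
    refine ⟨fun g => b (ρ g), ⟨C, fun g => hC _⟩, ?_⟩
    ext p
    simpa [coboundary1, pullbackCocycle] using congrFun hb (ρ p.1, ρ p.2))

/-- Applying a bounded homomorphism of coefficients to bounded cocycles. -/
def coeffCocycle (θ : NormedAddGroupHom V W) : boundedCocycles G V →+ boundedCocycles G W where
  toFun f := ⟨fun p => θ (f.1 p), by
    obtain ⟨C, hC⟩ := f.2.1
    refine ⟨⟨‖θ‖ * C, fun p => (θ.le_opNorm _).trans
      (mul_le_mul_of_nonneg_left (hC p) (norm_nonneg _))⟩, ?_⟩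
    have h : coboundary2 G V f.1 = 0 := f.2.2
    change coboundary2 G W _ = 0
    ext p
    simpa [coboundary2] using congrArg θ (congrFun h p)⟩
  map_zero' := by ext; simp
  map_add' _ _ := by ext; simp

/-- Change of coefficients on second bounded cohomology. -/
def H2b.coeff (θ : NormedAddGroupHom V W) : H2b G V →+ H2b G W :=
  QuotientAddGroup.map _ _ (coeffCocycle θ) (by
    rintro f ⟨b, ⟨C, hC⟩, hb⟩
    refine ⟨fun g => θ (b g), ⟨‖θ‖ * C, fun g => (θ.le_opNorm _).trans
      (mul_le_mul_of_nonneg_left (hC g) (norm_nonneg _))⟩, ?_⟩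
    ext p
    simpa [coboundary1, coeffCocycle] using congrArg θ (congrFun hb p))

/-- The inclusion of the integers into the reals, as a bounded homomorphism. -/
def intToReal : NormedAddGroupHom ℤ ℝ where
  toFun n := (n : ℝ)
  map_add' := by simp
  bound' := ⟨1, fun n => by simp [Int.norm_eq_abs]⟩

/-- The bounded cocycle given by the coboundary of a quasimorphism. -/
def IsQuasimorphism.cocycle {φ : G → ℝ} (hφ : IsQuasimorphism φ) : boundedCocycles G ℝ :=
  ⟨coboundary1 G ℝ φ, by
    obtain ⟨D, hD⟩ := hφ
    refine ⟨⟨D, fun p => ?_⟩, coboundary2_coboundary1 φ⟩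
    have h := hD p.1 p.2
    rw [Real.norm_eq_abs]
    convert h using 2
    simp [coboundary1]
    ring⟩

/-- The class in second real bounded cohomology of the coboundary of a quasimorphism. -/
def IsQuasimorphism.boundedClass {φ : G → ℝ} (hφ : IsQuasimorphism φ) : H2b G ℝ :=
  H2b.mk hφ.cocycle

end BoundedCohomology

/-! ### Homeomorphisms of the circle and the bounded Euler class -/

/-- Orientation preserving homeomorphisms of the real line commuting with integer translations.
The group law is composition. -/
def homeoZ : Subgroup (ℝ ≃ₜ ℝ) where
  carrier := {f | StrictMono f ∧ ∀ (n : ℤ) (x : ℝ), f (x + n) = f x + n}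
  one_mem' := ⟨strictMono_id, fun _ _ => rfl⟩
  mul_mem' := by
    rintro f g ⟨hf, hf'⟩ ⟨hg, hg'⟩
    exact ⟨hf.comp hg, fun n x => by simp [hf', hg']⟩
  inv_mem' := by
    rintro f ⟨hf, hf'⟩
    refine ⟨fun x y hxy => ?_, fun n x => ?_⟩
    · rw [← hf.lt_iff_lt]
      simpa using hxy
    · apply f.injective
      simp [hf']

/-- `f` is a lift of `h` along the projection from the line to the circle `ℝ / ℤ`. -/
def IsLift (f : ℝ ≃ₜ ℝ) (h : UnitAddCircle ≃ₜ UnitAddCircle) : Prop :=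
  ∀ x : ℝ, h (x : UnitAddCircle) = ((f x : ℝ) : UnitAddCircle)

theorem IsLift.mul {f f' : ℝ ≃ₜ ℝ} {h h' : UnitAddCircle ≃ₜ UnitAddCircle}
    (hf : IsLift f h) (hf' : IsLift f' h') : IsLift (f * f') (h * h') := fun x => by
  simp [hf' x, hf (f' x)]

theorem IsLift.inv {f : ℝ ≃ₜ ℝ} {h : UnitAddCircle ≃ₜ UnitAddCircle}
    (hf : IsLift f h) : IsLift f⁻¹ h⁻¹ := fun x => by
  apply h.injective
  simp [hf (f.symm x)]

/-- Orientation preserving homeomorphisms of the circle `ℝ / ℤ`: those which lift to an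
increasing homeomorphism of the line commuting with integer translations. -/
def homeoCircle : Subgroup (UnitAddCircle ≃ₜ UnitAddCircle) where
  carrier := {h | ∃ f ∈ homeoZ, IsLift f h}
  one_mem' := ⟨1, homeoZ.one_mem, fun _ => rfl⟩
  mul_mem' := by
    rintro h h' ⟨f, hf, hl⟩ ⟨f', hf', hl'⟩
    exact ⟨f * f', homeoZ.mul_mem hf hf', hl.mul hl'⟩
  inv_mem' := by
    rintro h ⟨f, hf, hl⟩
    exact ⟨f⁻¹, homeoZ.inv_mem hf, hl.inv⟩

theorem coe_eq_coe_iff {x y : ℝ} : (x : UnitAddCircle) = y ↔ ∃ n : ℤ, x = y + n := by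
  rw [← sub_eq_zero, ← AddCircle.coe_sub, AddCircle.coe_eq_zero_iff]
  constructor
  · rintro ⟨n, hn⟩
    exact ⟨n, by simp at hn; linarith⟩
  · rintro ⟨n, hn⟩
    exact ⟨n, by simp; linarith⟩

/-- A lift of the identity is an integer translation. -/
theorem exists_translation {f : ℝ ≃ₜ ℝ} (hf : f ∈ homeoZ) (hl : IsLift f 1) :
    ∃ n : ℤ, ∀ x, f x = x + n := by
  have key : ∀ x : ℝ, ∃ n : ℤ, f x = x + n := fun x => coe_eq_coe_iff.1 (hl x).symm
  obtain ⟨n, hn⟩ := key 0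
  refine ⟨n, fun x => ?_⟩
  have h0 : f (Int.fract x) = Int.fract x + n := by
    obtain ⟨m, hm⟩ := key (Int.fract x)
    have h1 : f 0 ≤ f (Int.fract x) := hf.1.monotone (Int.fract_nonneg x)
    have h2 : f (Int.fract x) < f (0 + (1 : ℤ)) :=
      hf.1 (by simpa using Int.fract_lt_one x)
    rw [hf.2 1 0] at h2
    have h3 := Int.fract_nonneg x
    have h4 := Int.fract_lt_one x
    have h5 : (m : ℝ) < n + 1 := by push_cast at h2; linarith
    have h6 : (n : ℝ) < m + 1 := by push_cast at h2; linarith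
    have h7 : m = n := by
      have h5' : m < n + 1 := by exact_mod_cast h5
      have h6' : n < m + 1 := by exact_mod_cast h6
      omega
    rw [hm, h7]
  have h8 := hf.2 ⌊x⌋ (Int.fract x)
  rw [Int.fract_add_floor, h0] at h8
  rw [h8]
  linarith [Int.fract_add_floor x]

/-- Every orientation preserving homeomorphism of the circle has a unique lift sending `0` into
`[0, 1)`. -/
theorem existsUnique_lift (h : homeoCircle) :
    ∃! f : ℝ ≃ₜ ℝ, f ∈ homeoZ ∧ IsLift f h ∧ f 0 ∈ Set.Ico (0 : ℝ) 1 := by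
  obtain ⟨f, hf, hl⟩ := h.2
  let t : ℝ ≃ₜ ℝ := Homeomorph.addRight (-(⌊f 0⌋ : ℝ))
  have ht : ∀ x, t x = x - ⌊f 0⌋ := fun x => by simp [t, sub_eq_add_neg]
  refine ⟨t * f, ⟨⟨?_, ?_⟩, ?_, ?_⟩, ?_⟩
  · intro x y hxy
    simp [ht, hf.1 hxy]
  · intro n x
    simp [ht, hf.2 n x]
    ring
  · intro x
    rw [hl x, coe_eq_coe_iff]
    exact ⟨⌊f 0⌋, by simp [ht]⟩
  · simp only [Homeomorph.mul_apply, ht]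
    exact ⟨Int.fract_nonneg (f 0), Int.fract_lt_one (f 0)⟩
  · rintro f' ⟨hf', hl', h0⟩
    have hi : IsLift (f⁻¹ * f') 1 := by simpa using hl.inv.mul hl'
    obtain ⟨n, hn⟩ := exists_translation (homeoZ.mul_mem (homeoZ.inv_mem hf) hf') hi
    have hn' : ∀ x, f' x = f x + n := fun x => by
      rw [← hf.2 n x, ← hn x]
      simp
    have h1 : n = -⌊f 0⌋ := by
      have h2 : ⌊f 0 + n⌋ = 0 := by rw [← hn', Int.floor_eq_zero_iff]; exact h0
      rw [Int.floor_add_intCast] at h2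
      omega
    ext x
    simp [ht, hn', h1, sub_eq_add_neg]

/-- The section sending `h` to its unique lift `f` with `f 0 ∈ [0, 1)`. -/
noncomputable def lift (h : homeoCircle) : ℝ ≃ₜ ℝ := (existsUnique_lift h).choose

theorem lift_spec (h : homeoCircle) :
    lift h ∈ homeoZ ∧ IsLift (lift h) h ∧ lift h 0 ∈ Set.Ico (0 : ℝ) 1 :=
  (existsUnique_lift h).choose_spec.1

theorem exists_eulerCocycle (g h : homeoCircle) :
    ∃ n : ℤ, ∀ x : ℝ, (lift g * lift h * (lift (g * h))⁻¹) x = x + n := by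
  obtain ⟨hg, hg', -⟩ := lift_spec g
  obtain ⟨hh, hh', -⟩ := lift_spec h
  obtain ⟨hk, hk', -⟩ := lift_spec (g * h)
  refine exists_translation (homeoZ.mul_mem (homeoZ.mul_mem hg hh) (homeoZ.inv_mem hk)) ?_
  simpa using (hg'.mul hh').mul hk'.inv

/-- The integer `n` such that `lift g * lift h * (lift (g * h))⁻¹` is translation by `n`. -/
noncomputable def eulerFun (p : homeoCircle × homeoCircle) : ℤ :=
  (exists_eulerCocycle p.1 p.2).choose

theorem eulerFun_spec (g h : homeoCircle) (x : ℝ) :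
    lift g (lift h x) = lift (g * h) x + eulerFun (g, h) := by
  have := (exists_eulerCocycle g h).choose_spec (lift (g * h) x)
  simpa [eulerFun] using this

theorem eulerFun_mem (g h : homeoCircle) : eulerFun (g, h) = 0 ∨ eulerFun (g, h) = 1 := by
  obtain ⟨hg, -, hg1, hg2⟩ := lift_spec g
  obtain ⟨-, -, hh1, hh2⟩ := lift_spec h
  obtain ⟨-, -, hk1, hk2⟩ := lift_spec (g * h)
  have h0 := eulerFun_spec g h 0
  have h1 : lift g 0 ≤ lift g (lift h 0) := hg.1.monotone hh1
  have h2 : lift g (lift h 0) < lift g (0 + (1 : ℤ)) := hg.1 (by simpa using hh2)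
  rw [hg.2 1 0] at h2
  push_cast at h2
  have h3 : (-1 : ℝ) < eulerFun (g, h) := by linarith
  have h4 : (eulerFun (g, h) : ℝ) < 2 := by linarith
  have h3' : -1 < eulerFun (g, h) := by exact_mod_cast h3
  have h4' : eulerFun (g, h) < 2 := by exact_mod_cast h4
  omega

/-- The bounded Euler cocycle. -/
noncomputable def eulerCocycle : boundedCocycles homeoCircle ℤ :=
  ⟨eulerFun, by
    refine ⟨⟨1, ?_⟩, ?_⟩
    · rintro ⟨g, h⟩
      rcases eulerFun_mem g h with h | h <;> simp [h]
    · change coboundary2 homeoCircle ℤ eulerFun = 0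
      ext ⟨g, h, k⟩
      have h1 := eulerFun_spec g h (lift k 0)
      have h2 := eulerFun_spec (g * h) k 0
      have h3 := eulerFun_spec h k 0
      have h4 := eulerFun_spec g (h * k) 0
      rw [h3, (lift_spec g).1.2, h4, h2, mul_assoc] at h1
      have h5 : ((eulerFun (h, k) - eulerFun (g * h, k) + eulerFun (g, h * k)
          - eulerFun (g, h) : ℤ) : ℝ) = 0 := by
        push_cast
        linarith
      have h6 : eulerFun (h, k) - eulerFun (g * h, k) + eulerFun (g, h * k)
          - eulerFun (g, h) = 0 := by exact_mod_cast h5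
      exact h6⟩

/-- The bounded Euler class, in `H²_b(Homeo⁺(S¹), ℤ)`. -/
noncomputable def boundedEulerClass : H2b homeoCircle ℤ := H2b.mk eulerCocycle

/-- The real bounded Euler class, in `H²_b(Homeo⁺(S¹), ℝ)`. -/
noncomputable def realBoundedEulerClass : H2b homeoCircle ℝ :=
  H2b.coeff intToReal boundedEulerClass

end LetterQM

/-! The word w = Φ(g₀) prescribes an idealized action of the free group on a circle. Since all
powers of w alternate, w has even length N and its powers are repetitions
(`even_length_of_pow_mem`). Put N marked points on the circle, fixed alternately by one and by the
other generator, and let a letter push everything strictly between two neighbouring fixed points as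
far as the end. Directions are chosen so that each letter of w pushes forward by one marked point;
then every further power of w gains a full turn. Only integer positions (`pos`) and completed turns
(`turns`) are recorded.

The number of turns of c⁻¹xd depends only on the difference of the positions reached by d and c and
on one unit step (`turns_invRev_append_cons`). Around a thin triangle these differences cancel, and
the condition on the letters forbids all three steps to agree in sign, so the turns add up to -1 or
-2 (`turns_thin`). If instead Φ(g)Φ(h) = Φ(gh), alternation forces concatenation or complete
cancellation of a factor (`exists_toWord_mul_eq`). Hence F(g) = -turns(Φ(g⁻¹)) has coboundary in {0,
1}, while F(g₀ⁿ) = n.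

The rest holds for any such F. Its homogenization stays within 1 of F, so it is at least 1 at g₀.
Its defect is at most 1 (`abs_homogenization_mul_sub_le`), and the easy half of Bavard duality
bounds scl. Finally F defines a total preorder on G × ℤ; for countable G it is realized on the line,
and the integer shift descends the action to the circle (`exists_line_action`,
`exists_circle_action`). -/

namespace LetterQM

open Filter Topology

/-! ### Homogenization of quasimorphisms with coboundary in {0, 1} -/

/-- An integral quasimorphism whose coboundary takes only the values `0` and `1`. -/
structure IsUnitQuasimorphism {G : Type*} [Group G] (F : G → ℤ) : Prop where
  map_one : F 1 = 0
  map_mul_le : ∀ g h, F (g * h) ≤ F g + F h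
  le_map_mul : ∀ g h, F g + F h ≤ F (g * h) + 1

theorem le_of_forall_nat_mul_le {x y C : ℝ} (h : ∀ n : ℕ, n * x ≤ n * y + C) : x ≤ y := by
  by_contra! hlt
  obtain ⟨n, hn⟩ := exists_nat_gt (C / (x - y))
  rw [div_lt_iff₀ (by linarith)] at hn
  nlinarith [h n]

namespace IsUnitQuasimorphism

variable {G : Type*} [Group G] {F : G → ℤ} (hF : IsUnitQuasimorphism F)
include hF

theorem map_pow_le (g : G) (n : ℕ) : F (g ^ n) ≤ n * F g := by
  induction n with
  | zero => simp [hF.map_one]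
  | succ n ih =>
    have := hF.map_mul_le (g ^ n) g
    rw [← pow_succ] at this
    push_cast
    linarith

theorem le_map_pow (g : G) (n : ℕ) : n * (F g - 1) ≤ F (g ^ n) := by
  induction n with
  | zero => simp [hF.map_one]
  | succ n ih =>
    have := hF.le_map_mul (g ^ n) g
    rw [← pow_succ] at this
    push_cast
    linarith

theorem exists_tendsto (g : G) :
    ∃ l : ℝ, Tendsto (fun n : ℕ => (F (g ^ n) : ℝ) / n) atTop (𝓝 l) := by
  have hsub : Subadditive (fun n : ℕ => (F (g ^ n) : ℝ)) := by
    intro m n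
    change (F (g ^ (m + n)) : ℝ) ≤ F (g ^ m) + F (g ^ n)
    rw [pow_add]
    exact_mod_cast hF.map_mul_le (g ^ m) (g ^ n)
  refine ⟨_, hsub.tendsto_lim ⟨min 0 ((F g : ℝ) - 1), ?_⟩⟩
  rintro _ ⟨n, rfl⟩
  rcases n.eq_zero_or_pos with rfl | hn
  · simp
  · have hn' : (0 : ℝ) < n := by exact_mod_cast hn
    refine (min_le_right _ _).trans ?_
    rw [le_div_iff₀ hn', mul_comm]
    exact_mod_cast hF.le_map_pow g n

omit hF in
/-- The homogenization of `F`. -/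
noncomputable def _root_.LetterQM.homogenization (F : G → ℤ) (g : G) : ℝ :=
  atTop.limUnder (fun n : ℕ => (F (g ^ n) : ℝ) / n)

theorem tendsto_homogenization (g : G) :
    Tendsto (fun n : ℕ => (F (g ^ n) : ℝ) / n) atTop (𝓝 (homogenization F g)) :=
  tendsto_nhds_limUnder (hF.exists_tendsto g)

theorem homogenization_le (g : G) : homogenization F g ≤ F g := by
  refine le_of_tendsto (hF.tendsto_homogenization g) ?_
  filter_upwards [eventually_gt_atTop 0] with n hn
  have hn' : (0 : ℝ) < n := by exact_mod_cast hn
  rw [div_le_iff₀ hn', mul_comm]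
  exact_mod_cast hF.map_pow_le g n

theorem le_homogenization (g : G) : (F g : ℝ) - 1 ≤ homogenization F g := by
  refine ge_of_tendsto (hF.tendsto_homogenization g) ?_
  filter_upwards [eventually_gt_atTop 0] with n hn
  have hn' : (0 : ℝ) < n := by exact_mod_cast hn
  rw [le_div_iff₀ hn', mul_comm]
  exact_mod_cast hF.le_map_pow g n

theorem homogenization_pow (g : G) (k : ℕ) :
    homogenization F (g ^ k) = k * homogenization F g := by
  rcases k.eq_zero_or_pos with rfl | hk
  · refine tendsto_nhds_unique (hF.tendsto_homogenization _) ?_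
    simp [hF.map_one]
  · refine tendsto_nhds_unique (hF.tendsto_homogenization _) ?_
    have h1 : Tendsto (fun n : ℕ => k * n) atTop atTop :=
      tendsto_id.const_mul_atTop' hk
    have h2 := ((hF.tendsto_homogenization g).comp h1).const_mul (k : ℝ)
    refine h2.congr fun n => ?_
    have hk' : (k : ℝ) ≠ 0 := by exact_mod_cast hk.ne'
    simp only [Function.comp, pow_mul, Nat.cast_mul]
    field_simp

/-- The integer F(x) + F(x⁻¹) lies in {0, 1}, so the values at powers of g and of g⁻¹ cancel up to a
bounded error, which disappears after dividing by the exponent. -/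
theorem homogenization_inv (g : G) : homogenization F g⁻¹ = -homogenization F g := by
  have h : ∀ n : ℕ, |homogenization F (g⁻¹ ^ n) + homogenization F (g ^ n)| ≤ 2 := fun n => by
    have h1 := hF.map_mul_le (g ^ n) (g⁻¹ ^ n)
    have h2 := hF.le_map_mul (g ^ n) (g⁻¹ ^ n)
    rw [inv_pow, mul_inv_cancel, hF.map_one] at h1 h2
    have h1' : (0 : ℝ) ≤ F (g ^ n) + F (g ^ n)⁻¹ := by exact_mod_cast h1
    have h2' : (F (g ^ n) : ℝ) + F (g ^ n)⁻¹ ≤ 1 := by exact_mod_cast h2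
    rw [inv_pow, abs_le]
    constructor <;> linarith [hF.homogenization_le (g ^ n), hF.le_homogenization (g ^ n),
      hF.homogenization_le (g ^ n)⁻¹, hF.le_homogenization (g ^ n)⁻¹]
  simp only [hF.homogenization_pow] at h
  refine le_antisymm (le_of_forall_nat_mul_le (C := 2) fun n => ?_)
    (le_of_forall_nat_mul_le (C := 2) fun n => ?_) <;>
  linarith [abs_le.1 (h n)]

theorem isHomogeneous_homogenization : IsHomogeneous (homogenization F) := by
  intro g n
  cases n with
  | ofNat n => simpa using hF.homogenization_pow g n
  | negSucc n =>
    rw [zpow_negSucc, hF.homogenization_inv, hF.homogenization_pow]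
    push_cast
    ring

/-- A translation estimate for a function close to `F` passes to the homogenization. -/
theorem abs_homogenization_sub_le {K : G → ℝ} {C c e : ℝ} (hK : ∀ y, |K y - F y| ≤ C) {g : G}
    (h : ∀ y, |K (g * y) - K y - c| ≤ e) : |homogenization F g - c| ≤ e := by
  have h1 : ∀ n : ℕ, |K (g ^ n) - K 1 - n * c| ≤ n * e := by
    intro n
    induction n with
    | zero => simp
    | succ n ih =>
      have h2 := h (g ^ n)
      rw [← pow_succ'] at h2
      rw [abs_le] at *
      push_cast
      constructor <;> linarith
  have h2 : ∀ n : ℕ, |n * (homogenization F g - c)| ≤ n * e + (C + |K 1| + 1) := by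
    intro n
    rw [mul_sub, ← hF.homogenization_pow]
    have h3 := h1 n
    have h4 := hK (g ^ n)
    have h5 := hF.homogenization_le (g ^ n)
    have h6 := hF.le_homogenization (g ^ n)
    have h7 := neg_abs_le (K 1)
    have h8 := le_abs_self (K 1)
    rw [abs_le] at h3 h4 ⊢
    constructor <;> linarith
  rw [abs_le]
  constructor
  · rw [← neg_le_neg_iff, neg_neg]
    refine le_of_forall_nat_mul_le (C := C + |K 1| + 1) fun n => ?_
    linarith [abs_le.1 (h2 n)]
  · refine le_of_forall_nat_mul_le (C := C + |K 1| + 1) fun n => ?_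
    linarith [abs_le.1 (h2 n)]

/-- The homogenization has defect at most one: averaging `F` over powers of `a` gives a
coordinate in which `a` is almost a translation, while `b` has oscillation at most one. -/
theorem abs_homogenization_mul_sub_le (a b : G) :
    |homogenization F a + homogenization F b - homogenization F (a * b)| ≤ 1 := by
  suffices h : ∀ n : ℕ, 0 < n →
      |homogenization F (a * b) - (homogenization F a + homogenization F b)| ≤ 1 + 1 / n by
    rw [abs_sub_comm]
    refine le_of_forall_pos_le_add fun ε hε => ?_
    obtain ⟨n, hn⟩ := exists_nat_one_div_lt hε
    refine (h (n + 1) n.succ_pos).trans ?_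
    push_cast
    linarith
  intro n hn
  have hn' : (0 : ℝ) < n := by exact_mod_cast hn
  let K : G → ℝ := fun y => (∑ i ∈ Finset.range n, (F (a ^ i * y) : ℝ)) / n
  have hK : ∀ y, |K y - F y| ≤ (∑ i ∈ Finset.range n, (|(F (a ^ i) : ℝ)| + 1)) / n := fun y => by
    have h1 : K y - F y = (∑ i ∈ Finset.range n, ((F (a ^ i * y) : ℝ) - F y)) / n := by
      simp only [K, Finset.sum_sub_distrib, Finset.sum_const, Finset.card_range, nsmul_eq_mul]
      field_simp
    rw [h1, abs_div, abs_of_pos hn']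
    gcongr
    refine (Finset.abs_sum_le_sum_abs _ _).trans (Finset.sum_le_sum fun i _ => ?_)
    have h2 : (F (a ^ i * y) : ℝ) ≤ F (a ^ i) + F y := by exact_mod_cast hF.map_mul_le _ _
    have h3 : (F (a ^ i) : ℝ) + F y ≤ F (a ^ i * y) + 1 := by exact_mod_cast hF.le_map_mul _ _
    have h7 := neg_abs_le (F (a ^ i) : ℝ)
    have h8 := le_abs_self (F (a ^ i) : ℝ)
    rw [abs_le]
    constructor <;> linarith
  have ha : ∀ y, |K (a * y) - K y - homogenization F a| ≤ 1 / n := fun y => by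
    -- Shifting the average by `a` telescopes, so that only the two end terms remain.
    have h1 : K (a * y) - K y = ((F (a ^ n * y) : ℝ) - F y) / n := by
      simp only [K, ← sub_div, ← Finset.sum_sub_distrib, ← mul_assoc, ← pow_succ]
      rw [Finset.sum_range_sub (fun i => (F (a ^ i * y) : ℝ)) n]
      simp
    have h2 : (F (a ^ n * y) : ℝ) ≤ F (a ^ n) + F y := by exact_mod_cast hF.map_mul_le _ _
    have h3 : (F (a ^ n) : ℝ) + F y ≤ F (a ^ n * y) + 1 := by exact_mod_cast hF.le_map_mul _ _
    have h4 := hF.homogenization_le (a ^ n)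
    have h5 := hF.le_homogenization (a ^ n)
    rw [hF.homogenization_pow] at h4 h5
    have h6 : K (a * y) - K y - homogenization F a
        = ((F (a ^ n * y) : ℝ) - F y - n * homogenization F a) / n := by
      rw [h1]
      field_simp
    rw [h6, abs_div, abs_of_pos hn']
    gcongr
    rw [abs_le]
    constructor <;> linarith
  -- The bounds on this increment do not involve `p`, so increments for two different `p` differ by
  -- at most 1.
  have hcmp : ∀ p y z, F (p * y) - F (p * z) ≤ F (z⁻¹ * y) ∧
      F (z⁻¹ * y) - 1 ≤ F (p * y) - F (p * z) := fun p y z => by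
    have h1 := hF.map_mul_le (p * z) (z⁻¹ * y)
    have h2 := hF.le_map_mul (p * z) (z⁻¹ * y)
    rw [show p * z * (z⁻¹ * y) = p * y by group] at h1 h2
    constructor <;> linarith
  have hosc : ∀ y z, |K (b * z) - K z - (K (b * y) - K y)| ≤ 1 := fun y z => by
    have h1 : K (b * z) - K z - (K (b * y) - K y) = (∑ i ∈ Finset.range n,
        (((F (a ^ i * (b * z)) - F (a ^ i * z) - (F (a ^ i * (b * y)) - F (a ^ i * y)) : ℤ)) : ℝ))
        / n := by
      simp only [K, ← sub_div, ← Finset.sum_sub_distrib]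
      push_cast
      rfl
    rw [h1, abs_div, abs_of_pos hn', div_le_one hn']
    refine (Finset.abs_sum_le_sum_abs _ _).trans ?_
    refine (Finset.sum_le_card_nsmul _ _ 1 fun i _ => ?_).trans (by simp)
    have h2 := hcmp (a ^ i * b) z y
    have h3 := hcmp (a ^ i) z y
    rw [mul_assoc, mul_assoc] at h2
    have h4 : |F (a ^ i * (b * z)) - F (a ^ i * z) - (F (a ^ i * (b * y)) - F (a ^ i * y))| ≤ 1 := by
      rw [abs_le]
      constructor <;> linarith
    exact_mod_cast h4
  -- Each single displacement of `b` serves as candidate constant: all other displacements lie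
  -- within 1 of it, hence so does their long-run mean.
  have hb : ∀ y, |K (b * y) - K y - homogenization F b| ≤ 1 := fun y => by
    rw [abs_sub_comm]
    exact hF.abs_homogenization_sub_le hK fun z => hosc y z
  refine hF.abs_homogenization_sub_le hK fun y => ?_
  have h1 := abs_le.1 (ha (b * y))
  have h2 := abs_le.1 (hb y)
  rw [mul_assoc, abs_le]
  constructor <;> linarith

theorem isQuasimorphism_homogenization : IsQuasimorphism (homogenization F) :=
  ⟨1, hF.abs_homogenization_mul_sub_le⟩

theorem defect_homogenization_le : defect (homogenization F) ≤ 1 :=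
  csInf_le ⟨0, fun _ hD => (abs_nonneg _).trans (hD 1 1)⟩ hF.abs_homogenization_mul_sub_le

end IsUnitQuasimorphism

/-! ### Bavard duality, easy direction -/

section Bavard

variable {G : Type*} [Group G] {φ : G → ℝ}

/-- Conjugation changes a quasimorphism by a bounded amount; applied to hⁿ, whose value grows
linearly, this forces equality. -/
theorem IsHomogeneous.map_conj (hφ : IsHomogeneous φ)
    {D : ℝ} (hD : ∀ g h, |φ g + φ h - φ (g * h)| ≤ D) (g h : G) : φ (g * h * g⁻¹) = φ h := by
  have key : ∀ n : ℕ, |φ (g * h ^ n * g⁻¹) - φ (h ^ n)| ≤ 2 * D := fun n => by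
    have h1 := abs_le.1 (hD (g * h ^ n) g⁻¹)
    have h2 := abs_le.1 (hD g (h ^ n))
    have h3 : φ g⁻¹ = -φ g := by simpa using hφ g (-1)
    rw [abs_le]
    constructor <;> linarith
  have hpow : ∀ (x : G) (n : ℕ), φ (x ^ n) = n * φ x := fun x n => by simpa using hφ x n
  simp only [← conj_pow, hpow] at key
  refine le_antisymm (le_of_forall_nat_mul_le (C := 2 * D) fun n => ?_)
    (le_of_forall_nat_mul_le (C := 2 * D) fun n => ?_) <;>
  linarith [abs_le.1 (key n)]

/-- The easy direction of Bavard duality. -/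
theorem IsHomogeneous.le_scl (hφ : IsHomogeneous φ)
    (hD : ∀ g h, |φ g + φ h - φ (g * h)| ≤ 1) {g : G} (hg : g ∈ commutator G) :
    φ g / 2 ≤ scl g := by
  have hprod : ∀ l : List (G × G),
      |φ (l.map fun p => p.1 * p.2 * p.1⁻¹ * p.2⁻¹).prod| ≤ 2 * l.length := by
    intro l
    induction l with
    | nil =>
      have : φ 1 = 0 := by simpa using hφ 1 0
      simp [this]
    | cons p l ih =>
      simp only [List.map_cons, List.prod_cons, List.length_cons]
      -- By conjugation invariance a single commutator has value at most 1 in modulus; multiplying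
      -- it to the rest costs another 1. Together these give the factor 2.
      have h1 := abs_le.1 (hD (p.1 * p.2 * p.1⁻¹ * p.2⁻¹)
        (l.map fun p => p.1 * p.2 * p.1⁻¹ * p.2⁻¹).prod)
      have h2 := abs_le.1 (hD (p.1 * p.2 * p.1⁻¹) p.2⁻¹)
      have h3 := hφ.map_conj hD p.1 p.2
      have h4 : φ p.2⁻¹ = -φ p.2 := by simpa using hφ p.2 (-1)
      rw [abs_le] at *
      push_cast
      constructor <;> linarith
  refine ge_of_tendsto (tendsto_scl hg) ?_
  filter_upwards [eventually_gt_atTop 0] with n hn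
  have hn' : (0 : ℝ) < n := by exact_mod_cast hn
  obtain ⟨l, hl, hl'⟩ := Nat.sInf_mem (commLengths_nonempty (pow_mem hg n))
  have h1 := hprod l
  rw [hl'] at h1
  have h2 : φ (g ^ n) = n * φ g := by simpa using hφ g n
  have h3 : ((cl (g ^ n) : ℕ) : ℝ) = l.length := by rw [hl]; rfl
  rw [h3, le_div_iff₀ hn']
  linarith [abs_le.1 h1]

end Bavard

end LetterQM

namespace LetterQM

/-! ### Walks of alternating words -/

/-- The sign of the exponent of a letter. -/
def expSign (b : Bool) : ℤ := cond b 1 (-1)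

theorem expSign_eq (b : Bool) : expSign b = 1 ∨ expSign b = -1 := by cases b <;> simp [expSign]

@[simp] theorem expSign_not (b : Bool) : expSign (!b) = -expSign b := by
  cases b <;> simp [expSign]

/-- The word `L` alternates and does not start with a power of the generator `i`. -/
def AltFrom : Fin 2 → List (Fin 2 × Bool) → Prop
  | _, [] => True
  | i, x :: L => i ≠ x.1 ∧ AltFrom x.1 L

/-- The word `L` alternates. -/
abbrev IsAlt (L : List (Fin 2 × Bool)) : Prop := L.IsChain (fun x y => x.1 ≠ y.1)

theorem isAlt_cons {x : Fin 2 × Bool} {L : List (Fin 2 × Bool)} :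
    IsAlt (x :: L) ↔ AltFrom x.1 L := by
  induction L generalizing x with
  | nil => simp [AltFrom]
  | cons y L ih => simp [AltFrom, IsAlt, List.isChain_cons_cons, ← ih]

theorem IsAlt.invRev {L : List (Fin 2 × Bool)} (h : IsAlt L) : IsAlt (FreeGroup.invRev L) := by
  rw [IsAlt, FreeGroup.invRev, List.isChain_reverse, List.isChain_map]
  exact h.imp fun _ _ h => h.symm

theorem altFrom_iff {i : Fin 2} {L : List (Fin 2 × Bool)} :
    AltFrom i L ↔ IsAlt ((i, true) :: L) :=
  (isAlt_cons (x := (i, true))).symm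

theorem invRev_append (L M : List (Fin 2 × Bool)) :
    FreeGroup.invRev (L ++ M) = FreeGroup.invRev M ++ FreeGroup.invRev L := by
  simp [FreeGroup.invRev]

theorem invRev_cons (x : Fin 2 × Bool) (L : List (Fin 2 × Bool)) :
    FreeGroup.invRev (x :: L) = FreeGroup.invRev L ++ [(x.1, !x.2)] := by
  simp [FreeGroup.invRev]

/-- A circle carrying `N` marked points, whose lifts to the line are the integers, alternately
fixed by one and by the other generator. The sign `s j` tells in which direction the generator
not fixing `j` pushes the interval `(j - 1, j + 1)`. The basepoint lies in `(0, 1)`; it is in the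
interval around `start i` pushed by the generator `i`. -/
structure SignPattern where
  N : ℤ
  N_pos : 0 < N
  N_even : N % 2 = 0
  s : ℤ → ℤ
  s_eq : ∀ j, s j = 1 ∨ s j = -1
  s_add : ∀ j m, s (j + N * m) = s j
  start : Fin 2 → ℤ
  start_eq : ∀ i, start i = 0 ∨ start i = 1
  start_ne : ∀ i j, i ≠ j → start i ≠ start j

namespace SignPattern

variable (P : SignPattern)

/-- The point where a word carries a marked point. The last letter acts first. -/
def act (L : List (Fin 2 × Bool)) (y : ℤ) : ℤ :=
  L.foldr (fun x y => y + expSign x.2 * P.s y) y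

/-- The point where a word carries the basepoint; `i` matters for the empty word only, where the
result is the center of the interval of the generator `i` containing the basepoint. -/
def pos : List (Fin 2 × Bool) → Fin 2 → ℤ
  | [], i => P.start i
  | x :: L, _ => pos L x.1 + expSign x.2 * P.s (pos L x.1)

/-- The number of full turns which a word makes the basepoint travel. -/
def turns : List (Fin 2 × Bool) → ℤ
  | [] => 0
  | x :: L => (P.pos (x :: L) x.1 - 1) / P.N

theorem step_eq (y : ℤ) (b : Bool) :
    expSign b * P.s y = 1 ∨ expSign b * P.s y = -1 := by
  rcases expSign_eq b with h | h <;> rcases P.s_eq y with h' | h' <;> simp [h, h']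

theorem mul_N_even (m : ℤ) : P.N * m % 2 = 0 := by
  rw [Int.mul_emod, P.N_even]
  simp

theorem act_append (L M : List (Fin 2 × Bool)) (y : ℤ) :
    P.act (L ++ M) y = P.act L (P.act M y) := by
  simp [act, List.foldr_append]

theorem pos_append_cons (L M : List (Fin 2 × Bool)) (x : Fin 2 × Bool) (i j : Fin 2) :
    P.pos (L ++ x :: M) i = P.act L (P.pos (x :: M) j) := by
  induction L generalizing i with
  | nil => rfl
  | cons y L ih => simp only [List.cons_append, pos, ih, act, List.foldr_cons]

theorem turns_of_ne_nil {L : List (Fin 2 × Bool)} (h : L ≠ []) (i : Fin 2) :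
    P.turns L = (P.pos L i - 1) / P.N := by
  cases L with
  | nil => exact absurd rfl h
  | cons x L => rfl

/-- A word not starting with `i` carries the basepoint to a center of an interval of `i`, never to a
fixed point of `i`, so that a next letter in `i` really pushes. -/
theorem pos_emod {i : Fin 2} {L : List (Fin 2 × Bool)} (h : AltFrom i L) :
    (P.pos L i - P.start i) % 2 = 0 := by
  induction L generalizing i with
  | nil => simp [pos]
  | cons x L ih =>
    have h1 := ih h.2
    have h2 := P.step_eq (P.pos L x.1) x.2
    have h3 := P.start_ne _ _ h.1
    have h4 := P.start_eq i
    have h5 := P.start_eq x.1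
    simp only [pos]
    omega

/-- Acting by the inverse word is adjoint to acting by the word. -/
theorem le_act_invRev_iff (c : List (Fin 2 × Bool)) (i : Fin 2) (y : ℤ) (hc : AltFrom i c)
    (hy : (y - P.start i) % 2 = 1) (m : ℤ) :
    1 + P.N * m ≤ P.act (FreeGroup.invRev c) y ↔ P.pos c i + P.N * m < y := by
  have hm := P.mul_N_even m
  induction c generalizing i y with
  | nil =>
    have := P.start_eq i
    simp only [FreeGroup.invRev, List.map_nil, List.reverse_nil, act, List.foldr_nil, pos]
    omega
  | cons z c ih =>
    have h2 := P.start_ne _ _ hc.1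
    have h3 := P.start_eq i
    have h4 := P.start_eq z.1
    have h5 := P.step_eq y z.2
    have h6 := P.step_eq (P.pos c z.1) z.2
    have h7 := P.pos_emod hc.2
    have h8 := P.s_add (P.pos c z.1) m
    rw [invRev_cons, act_append]
    have h1 : P.act [(z.1, !z.2)] y = y - expSign z.2 * P.s y := by
      simp [act, sub_eq_add_neg]
    have h9 := ih z.1 (y - expSign z.2 * P.s y) hc.2 (by omega)
    rw [h1]
    refine h9.trans ?_
    simp only [pos]
    -- Both points are moved by the same generator, so they have equal parity. If they coincide,
    -- they are pushed alike; otherwise they are at least 2 apart and a unit step of either cannot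
    -- reverse their order.
    rcases eq_or_ne y (P.pos c z.1 + P.N * m) with h | h
    · rw [← h] at h8
      rw [h8] at h5 ⊢
      omega
    · omega

/-- Adjointness moves c⁻¹ to the other side: c⁻¹xd carries the basepoint past its m-th translate
exactly when xd carries it past the m-th translate of where c does. Comparing all m gives the floor.
-/
theorem turns_invRev_append_cons {c d : List (Fin 2 × Bool)} {x : Fin 2 × Bool}
    (hc : AltFrom x.1 c) (hd : AltFrom x.1 d) :
    P.turns (FreeGroup.invRev c ++ x :: d)
      = (P.pos d x.1 - P.pos c x.1 + expSign x.2 * P.s (P.pos d x.1) - 1) / P.N := by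
  rw [P.turns_of_ne_nil (by simp) x.1, P.pos_append_cons _ _ _ _ x.1]
  refine eq_of_forall_le_iff fun m => ?_
  have h1 := P.pos_emod hd
  have h2 := P.step_eq (P.pos d x.1) x.2
  have h3 := P.le_act_invRev_iff c x.1 (P.pos (x :: d) x.1) hc (by simp only [pos]; omega) m
  rw [Int.le_ediv_iff_mul_le P.N_pos, Int.le_ediv_iff_mul_le P.N_pos, mul_comm m]
  simp only [pos] at h3 ⊢
  omega

theorem turns_append_cons {c d : List (Fin 2 × Bool)} {x : Fin 2 × Bool}
    (hc : AltFrom x.1 c) (hd : AltFrom x.1 d) :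
    P.turns (FreeGroup.invRev c ++ x :: d)
      = (P.pos (x :: d) x.1 - P.pos c x.1 - 1) / P.N := by
  rw [P.turns_invRev_append_cons hc hd]
  congr 1
  simp only [pos]
  ring

/-- The value of the floor in `turns_invRev_append_cons`. -/
theorem ediv_eq {y z : ℤ} (h : (z - y) % 2 = 0) {b : Bool} :
    ∃ q r : ℤ, z - y = P.N * q + r ∧ 0 ≤ r ∧ r < P.N ∧
      ((0 < r ∧ (z - y + expSign b * P.s z - 1) / P.N = q) ∨
      (r = 0 ∧ P.s z = P.s y ∧ expSign b * P.s z = 1 ∧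
        (z - y + expSign b * P.s z - 1) / P.N = q) ∨
      (r = 0 ∧ P.s z = P.s y ∧ expSign b * P.s z = -1 ∧
        (z - y + expSign b * P.s z - 1) / P.N = q - 1)) := by
  have hN := P.N_pos
  have hN2 := P.N_even
  have h1 := Int.mul_ediv_add_emod (z - y) P.N
  have h2 := Int.emod_nonneg (z - y) hN.ne'
  have h3 := Int.emod_lt_of_pos (z - y) hN
  set q := (z - y) / P.N
  set r := (z - y) % P.N
  have hq := P.mul_N_even q
  have h4 := P.step_eq z b
  refine ⟨q, r, h1.symm, h2, h3, ?_⟩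
  have hfloor : ∀ x k : ℤ, P.N * k ≤ x → x < P.N * k + P.N → x / P.N = k := fun x k h5 h6 => by
    rw [Int.ediv_eq_iff_of_pos hN]
    constructor <;> linarith
  -- All differences are even, so a nonzero remainder lies between 2 and N - 2 and absorbs the step;
  -- for remainder 0 the direction of the step decides.
  rcases h2.eq_or_lt with h0 | h0
  · right
    have hs : P.s z = P.s y := by
      rw [← P.s_add y q]
      congr 1
      omega
    rcases h4 with h4 | h4
    · exact Or.inl ⟨h0.symm, hs, h4, hfloor _ _ (by omega) (by omega)⟩
    · refine Or.inr ⟨h0.symm, hs, h4, hfloor _ _ ?_ ?_⟩ <;> rw [mul_sub, mul_one] <;> omega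
  · exact Or.inl ⟨h0, hfloor _ _ (by omega) (by omega)⟩

/-- This is ⌊-t⌋ = -1 - ⌊t⌋ for t not an integer: a nonempty word never returns the basepoint
exactly to one of its translates. In the degenerate case of remainder 0, the letter and its inverse
step in opposite directions. -/
theorem turns_invRev {L : List (Fin 2 × Bool)} (h : IsAlt L) (hL : L ≠ []) :
    P.turns (FreeGroup.invRev L) = -1 - P.turns L := by
  cases L with
  | nil => exact absurd rfl hL
  | cons x L =>
    have hx : AltFrom x.1 L := isAlt_cons.1 h
    have h1 := P.turns_invRev_append_cons (x := x) (c := []) trivial hx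
    have h2 := P.turns_invRev_append_cons (x := (x.1, !x.2)) (d := []) hx trivial
    rw [show FreeGroup.invRev [] ++ x :: L = x :: L from rfl] at h1
    rw [invRev_cons, h1, h2]
    have h3 := P.pos_emod hx
    simp only [pos, expSign_not]
    obtain ⟨q, r, ha, hb, hc, hd⟩ := P.ediv_eq (y := P.start x.1) (z := P.pos L x.1) h3 (b := x.2)
    obtain ⟨q', r', ha', hb', hc', hd'⟩ := P.ediv_eq (z := P.start x.1) (y := P.pos L x.1)
      (by omega) (b := !x.2)
    rw [expSign_not] at hd'
    have hN := P.N_pos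
    have hsum : P.N * (q + q') + (r + r') = 0 := by rw [mul_add]; omega
    have hq : q + q' = 0 ∨ q + q' = -1 := by
      have h5 : q + q' < 1 := by by_contra!; nlinarith
      have h6 : -2 < q + q' := by by_contra!; nlinarith
      omega
    have hneg : ∀ e t : ℤ, -e * t = -(e * t) := fun e t => by ring
    rcases hq with hq | hq <;> rw [hq] at hsum <;>
    rcases hd with hd | ⟨hr, hs, he, hd⟩ | ⟨hr, hs, he, hd⟩ <;>
    rcases hd' with hd' | ⟨hr', hs', he', hd'⟩ | ⟨hr', hs', he', hd'⟩ <;>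
    first
      | omega
      | (rw [hs', hneg, he] at he'; omega)

/-- Adjointness turns the count for LM into the floor of a difference of the positions reached by M
and by L⁻¹, which is compared with the difference of floors. -/
theorem turns_append {L M : List (Fin 2 × Bool)} (h : IsAlt (L ++ M)) (hL : L ≠ []) (hM : M ≠ []) :
    P.turns (L ++ M) = P.turns L + P.turns M ∨ P.turns (L ++ M) = P.turns L + P.turns M + 1 := by
  cases M with
  | nil => exact absurd rfl hM
  | cons x M =>
    obtain ⟨hL', hM', hj⟩ := List.isChain_append.1 h
    have hc : AltFrom x.1 (FreeGroup.invRev L) := by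
      rw [altFrom_iff]
      have h1 : IsAlt (FreeGroup.invRev (L ++ [(x.1, false)])) := by
        refine IsAlt.invRev (List.isChain_append.2 ⟨hL', by simp, ?_⟩)
        simpa using hj
      simpa [invRev_append, FreeGroup.invRev] using h1
    have hLL : FreeGroup.invRev L ≠ [] := by simpa [FreeGroup.invRev] using hL
    have h1 := P.turns_append_cons hc (isAlt_cons.1 hM')
    have h2 := P.turns_invRev hL' hL
    rw [FreeGroup.invRev_invRev] at h1
    rw [P.turns_of_ne_nil hLL x.1] at h2
    rw [h1, P.turns_of_ne_nil (List.cons_ne_nil x M) x.1]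
    have hN := P.N_pos
    generalize P.pos (x :: M) x.1 = V at *
    generalize P.pos (FreeGroup.invRev L) x.1 = C at *
    have e1 := Int.mul_ediv_add_emod (V - 1) P.N
    have e2 := Int.emod_nonneg (V - 1) hN.ne'
    have e3 := Int.emod_lt_of_pos (V - 1) hN
    have f1 := Int.mul_ediv_add_emod (C - 1) P.N
    have f2 := Int.emod_nonneg (C - 1) hN.ne'
    have f3 := Int.emod_lt_of_pos (C - 1) hN
    have g1 := Int.mul_ediv_add_emod (V - C - 1) P.N
    have g2 := Int.emod_nonneg (V - C - 1) hN.ne'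
    have g3 := Int.emod_lt_of_pos (V - C - 1) hN
    set a := (V - 1) / P.N
    set b := (C - 1) / P.N
    set d := (V - C - 1) / P.N
    have hsum : P.N * (d - a + b) = (V - 1) % P.N - (C - 1) % P.N - (V - C - 1) % P.N - 1 := by
      rw [mul_add, mul_sub]
      omega
    have k1 : d - a + b < 1 := by by_contra!; nlinarith
    have k2 : -2 < d - a + b := by by_contra!; nlinarith
    omega

theorem turns_thin {i : Fin 2} {c₁ c₂ c₃ : List (Fin 2 × Bool)} {b₁ b₂ b₃ : Bool}
    (h₁ : AltFrom i c₁) (h₂ : AltFrom i c₂) (h₃ : AltFrom i c₃)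
    (hb : expSign b₁ + expSign b₂ + expSign b₃ = 1 ∨ expSign b₁ + expSign b₂ + expSign b₃ = -1) :
    P.turns (FreeGroup.invRev c₁ ++ (i, b₁) :: c₂) + P.turns (FreeGroup.invRev c₂ ++ (i, b₂) :: c₃)
      + P.turns (FreeGroup.invRev c₃ ++ (i, b₃) :: c₁) = -1 ∨
    P.turns (FreeGroup.invRev c₁ ++ (i, b₁) :: c₂) + P.turns (FreeGroup.invRev c₂ ++ (i, b₂) :: c₃)
      + P.turns (FreeGroup.invRev c₃ ++ (i, b₃) :: c₁) = -2 := by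
  rw [P.turns_invRev_append_cons h₁ h₂, P.turns_invRev_append_cons h₂ h₃,
    P.turns_invRev_append_cons h₃ h₁]
  dsimp only
  have p₁ := P.pos_emod h₁
  have p₂ := P.pos_emod h₂
  have p₃ := P.pos_emod h₃
  have hs := P.s_eq (P.pos c₁ i)
  generalize P.pos c₁ i = y₁ at *
  generalize P.pos c₂ i = y₂ at *
  generalize P.pos c₃ i = y₃ at *
  obtain ⟨q₁, r₁, a₁, l₁, u₁, k₁⟩ := P.ediv_eq (y := y₁) (z := y₂) (by omega) (b := b₁)
  obtain ⟨q₂, r₂, a₂, l₂, u₂, k₂⟩ := P.ediv_eq (y := y₂) (z := y₃) (by omega) (b := b₂)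
  obtain ⟨q₃, r₃, a₃, l₃, u₃, k₃⟩ := P.ediv_eq (y := y₃) (z := y₁) (by omega) (b := b₃)
  have hN := P.N_pos
  have hsum : P.N * (q₁ + q₂ + q₃) + (r₁ + r₂ + r₃) = 0 := by rw [mul_add, mul_add]; omega
  have hq : q₁ + q₂ + q₃ = 0 ∨ q₁ + q₂ + q₃ = -1 ∨ q₁ + q₂ + q₃ = -2 := by
    have h5 : q₁ + q₂ + q₃ < 1 := by by_contra!; nlinarith
    have h6 : -3 < q₁ + q₂ + q₃ := by by_contra!; nlinarith
    omega
  -- If all remainders vanish, the three points agree modulo N and share one direction. The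
  -- quotients sum to 0, and each backward step subtracts 1; the condition on the exponents leaves
  -- one or two of them.
  by_cases hr : r₁ = 0 ∧ r₂ = 0 ∧ r₃ = 0
  · obtain ⟨rfl, rfl, rfl⟩ := hr
    have hq' : q₁ + q₂ + q₃ = 0 := by
      rcases hq with hq | hq | hq <;> rw [hq] at hsum <;> omega
    have hs₂ : P.s y₂ = P.s y₁ := by
      rcases k₁ with k | k | k
      · omega
      · exact k.2.1
      · exact k.2.1
    have hs₃ : P.s y₃ = P.s y₁ := by
      rw [← hs₂]
      rcases k₂ with k | k | k
      · omega
      · exact k.2.1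
      · exact k.2.1
    rw [hs₂] at k₁ ⊢
    rw [hs₃] at k₂ ⊢
    rcases hs with hs | hs <;> rw [hs] at k₁ k₂ k₃ ⊢ <;> omega
  -- Otherwise the remainders sum to N or 2N. At most one of them vanishes, and none if the sum is
  -- 2N, so a backward step lowers the total only from -1 to -2.
  · rcases hq with hq | hq | hq <;> rw [hq] at hsum <;> omega

end SignPattern

theorem expSign_sum_of_letter {i : Fin 2} {b₁ b₂ b₃ : Bool}
    (h : letter (i, b₁) * letter (i, b₂) * letter (i, b₃) = letter (i, true) ∨
      letter (i, b₁) * letter (i, b₂) * letter (i, b₃) = letter (i, false)) :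
    expSign b₁ + expSign b₂ + expSign b₃ = 1 ∨ expSign b₁ + expSign b₂ + expSign b₃ = -1 := by
  revert i b₁ b₂ b₃
  decide

end LetterQM

namespace LetterQM

/-! ### Products of alternating words -/

/-- C is the maximal part of U that cancels against V, found by stripping inverse letters at the
junction. -/
theorem exists_cancellation (U V : List (Fin 2 × Bool)) :
    ∃ A B C : List (Fin 2 × Bool), U = A ++ C ∧ V = FreeGroup.invRev C ++ B ∧
      ∀ x ∈ A.getLast?, ∀ y ∈ B.head?, x.1 = y.1 → x.2 = y.2 := by
  induction U using List.reverseRecOn generalizing V with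
  | nil => exact ⟨[], V, [], by simp [FreeGroup.invRev]⟩
  | append_singleton U x ih =>
    cases V with
    | nil => exact ⟨U ++ [x], [], [], by simp [FreeGroup.invRev]⟩
    | cons y V =>
      by_cases h : y = (x.1, !x.2)
      · obtain ⟨A, B, C, rfl, rfl, hAB⟩ := ih V
        exact ⟨A, B, C ++ [x], by simp, by simp [h, FreeGroup.invRev], hAB⟩
      · refine ⟨U ++ [x], y :: V, [], by simp, by simp [FreeGroup.invRev], ?_⟩
        simp only [List.getLast?_append, List.getLast?_singleton, List.head?_cons, Option.mem_def]
        rintro _ ⟨⟩ _ ⟨⟩ hxy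
        by_contra hne
        exact h (Prod.ext hxy.symm (by cases hx : x.2 <;> cases hy : y.2 <;> simp_all))

theorem isReduced_append {A B : List (Fin 2 × Bool)} (hA : FreeGroup.IsReduced A)
    (hB : FreeGroup.IsReduced B)
    (hAB : ∀ x ∈ A.getLast?, ∀ y ∈ B.head?, x.1 = y.1 → x.2 = y.2) :
    FreeGroup.IsReduced (A ++ B) :=
  List.isChain_append.2 ⟨hA, hB, hAB⟩

/-- If the product of two alternating words alternates, then it is a concatenation or one of the
factors cancels completely. -/
theorem exists_toWord_mul_eq {u v : F2} (hu : u ∈ altWords) (hv : v ∈ altWords)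
    (huv : u * v ∈ altWords) :
    ∃ A B C : List (Fin 2 × Bool), u.toWord = A ++ C ∧ v.toWord = FreeGroup.invRev C ++ B ∧
      (u * v).toWord = A ++ B ∧ (A = [] ∨ B = [] ∨ C = []) := by
  obtain ⟨A, B, C, hU, hV, hAB⟩ := exists_cancellation u.toWord v.toWord
  have hu' : IsAlt (A ++ C) := hU ▸ hu
  have hv' : IsAlt (FreeGroup.invRev C ++ B) := hV ▸ hv
  have hru : FreeGroup.IsReduced (A ++ C) := hU ▸ FreeGroup.isReduced_toWord
  have hrv : FreeGroup.IsReduced (FreeGroup.invRev C ++ B) := hV ▸ FreeGroup.isReduced_toWord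
  have hmul : u * v = FreeGroup.mk (A ++ B) := by
    rw [← FreeGroup.mk_toWord (x := u), ← FreeGroup.mk_toWord (x := v), hU, hV,
      ← FreeGroup.mul_mk, ← FreeGroup.mul_mk, ← FreeGroup.mul_mk, ← FreeGroup.inv_mk]
    group
  have hW : (u * v).toWord = A ++ B := by
    rw [hmul, FreeGroup.toWord_mk]
    exact (isReduced_append (List.isChain_append.1 hru).1 (List.isChain_append.1 hrv).2.1
      hAB).reduce_eq
  refine ⟨A, B, C, hU, hV, hW, ?_⟩
  have hw' : IsAlt (A ++ B) := hW ▸ huv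
  -- Otherwise the last letter of A and the first letters of B and C would belong to three different
  -- generators, but there are only two.
  by_contra! h
  obtain ⟨hA, hB, hC⟩ := h
  obtain ⟨A, x, rfl⟩ := List.eq_nil_or_concat' A |>.resolve_left hA
  obtain ⟨y, B, rfl⟩ := List.exists_cons_of_ne_nil hB
  obtain ⟨z, C, rfl⟩ := List.exists_cons_of_ne_nil hC
  have h1 : x.1 ≠ y.1 := (List.isChain_append.1 hw').2.2 x (by simp) y (by simp)
  have h2 : x.1 ≠ z.1 := (List.isChain_append.1 hu').2.2 x (by simp) z (by simp)
  have h3 : z.1 ≠ y.1 :=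
    (List.isChain_append.1 hv').2.2 (z.1, !z.2) (by simp [invRev_cons]) y (by simp)
  omega

theorem SignPattern.turns_mul (P : SignPattern) {u v : F2} (hu : u ∈ altWords)
    (hv : v ∈ altWords) (huv : u * v ∈ altWords) :
    P.turns (u * v).toWord = P.turns u.toWord + P.turns v.toWord ∨
      P.turns (u * v).toWord = P.turns u.toWord + P.turns v.toWord + 1 := by
  obtain ⟨A, B, C, hU, hV, hW, h⟩ := exists_toWord_mul_eq hu hv huv
  have hu' : IsAlt (A ++ C) := hU ▸ hu
  have hv' : IsAlt (FreeGroup.invRev C ++ B) := hV ▸ hv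
  have hw' : IsAlt (A ++ B) := hW ▸ huv
  rw [hU, hV, hW]
  have t0 : P.turns [] = 0 := rfl
  by_cases hC : C = []
  · subst hC
    rw [show FreeGroup.invRev [] = ([] : List (Fin 2 × Bool)) from rfl]
    rw [List.append_nil, List.nil_append] at *
    by_cases hA : A = []
    · subst hA; simp [t0]
    by_cases hB : B = []
    · subst hB; simp [t0]
    exact P.turns_append hw' hA hB
  have hiC : FreeGroup.invRev C ≠ [] := by simpa [FreeGroup.invRev] using hC
  have hCalt := (List.isChain_append.1 hu').2.1
  have h1 := P.turns_invRev hCalt hC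
  rcases h with rfl | rfl | h
  · rw [List.nil_append, List.nil_append]
    by_cases hB : B = []
    · subst hB
      rw [List.append_nil, h1, t0]
      omega
    · have := P.turns_append hv' hiC hB
      omega
  · rw [List.append_nil, List.append_nil, h1]
    by_cases hA : A = []
    · subst hA
      rw [List.nil_append, t0]
      omega
    · have := P.turns_append hu' hA hC
      omega
  · exact absurd h hC

/-- The number of turns defines an integral quasimorphism with coboundary in `{-1, 0}`. -/
theorem SignPattern.turns_map_mul (P : SignPattern) {G : Type*} [Group G] {Φ : G → F2}
    (hΦ : IsLetterQuasimorphism Φ) (g h : G) :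
    P.turns (Φ (g * h)).toWord = P.turns (Φ g).toWord + P.turns (Φ h).toWord ∨
      P.turns (Φ (g * h)).toWord = P.turns (Φ g).toWord + P.turns (Φ h).toWord + 1 := by
  rcases hΦ.thin g h with h1 | ⟨c₁, -, c₂, -, c₃, -, i, b₁, b₂, b₃, hb, e₁, e₂, e₃⟩
  · have h2 : Φ (g * h) = Φ g * Φ h := (mul_inv_eq_one.1 h1).symm
    rw [h2]
    exact P.turns_mul (hΦ.mem_altWords g) (hΦ.mem_altWords h) (h2 ▸ hΦ.mem_altWords (g * h))
  · have hgh : IsAlt (Φ (g * h))⁻¹.toWord := by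
      rw [FreeGroup.toWord_inv]
      exact IsAlt.invRev (hΦ.mem_altWords (g * h))
    have hg : IsAlt (Φ g).toWord := hΦ.mem_altWords g
    have hh : IsAlt (Φ h).toWord := hΦ.mem_altWords h
    simp only [IsReducedProduct, FreeGroup.toWord_inv, List.append_assoc, List.cons_append,
      List.nil_append] at e₁ e₂ e₃ hgh
    rw [e₁] at hg
    rw [e₂] at hh
    rw [e₃] at hgh
    have a₂ := isAlt_cons.1 (List.isChain_append.1 hg).2.1
    have a₃ := isAlt_cons.1 (List.isChain_append.1 hh).2.1
    have a₁ := isAlt_cons.1 (List.isChain_append.1 hgh).2.1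
    have h3 := P.turns_thin (b₁ := b₁) (b₂ := b₂) (b₃ := b₃) a₁ a₂ a₃ (expSign_sum_of_letter hb)
    rw [← e₁, ← e₂, ← e₃] at h3
    have hne : (Φ (g * h)).toWord ≠ [] := by
      intro h0
      rw [h0] at e₃
      exact absurd e₃ (by simp [FreeGroup.invRev])
    have h4 := P.turns_invRev (hΦ.mem_altWords (g * h)) hne
    omega

/-- The minus sign turns superadditivity of the turns into subadditivity. Passing to inverses makes
the values positive on words that travel forward: for Φ(g) ≠ 1 the value is the number of turns of
Φ(g) plus 1. -/
theorem SignPattern.isUnitQuasimorphism (P : SignPattern) {G : Type*} [Group G] {Φ : G → F2}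
    (hΦ : IsLetterQuasimorphism Φ) :
    IsUnitQuasimorphism (fun g => -P.turns (Φ g⁻¹).toWord) where
  map_one := by
    have h1 : Φ 1 = 1 := by
      have h2 := hΦ.map_inv 1
      rw [inv_one, eq_comm, inv_eq_self] at h2
      exact h2
    rw [inv_one, h1, FreeGroup.toWord_one]
    rfl
  map_mul_le g h := by
    have := P.turns_map_mul hΦ h⁻¹ g⁻¹
    rw [← mul_inv_rev] at this
    omega
  le_map_mul g h := by
    have := P.turns_map_mul hΦ h⁻¹ g⁻¹
    rw [← mul_inv_rev] at this
    omega

/-! ### The sign pattern of a word -/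

/-- The sign pattern for which a given word travels around the circle. -/
def SignPattern.ofWord (L : List (Fin 2 × Bool)) (hL : L ≠ []) (h : L.length % 2 = 0) :
    SignPattern where
  N := L.length
  N_pos := by exact_mod_cast List.length_pos_of_ne_nil hL
  N_even := by exact_mod_cast h
  -- Letters are read from the end, since the last one acts first; the sign at j makes the j-th
  -- letter push forward. The index is always in range, so the default is never used.
  s j := expSign (L.reverse.getD (j % L.length).toNat (0, true)).2
  s_eq j := expSign_eq _
  s_add j m := by simp
  start i := if i = (L.getLast hL).1 then 0 else 1
  start_eq i := by split_ifs <;> simp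
  start_ne i j hij := by
    generalize (L.getLast hL).1 = k
    revert i j k
    decide

theorem SignPattern.ofWord_act {L : List (Fin 2 × Bool)} (hL : L ≠ []) (h : L.length % 2 = 0)
    (n : ℕ) : (ofWord L hL h).act L (L.length * n) = L.length * (n + 1) := by
  suffices key : ∀ A B, L = A ++ B →
      (ofWord L hL h).act B (L.length * n) = L.length * n + B.length by
    rw [key [] L rfl]
    ring
  intro A B hAB
  induction B generalizing A with
  | nil => simp [act]
  | cons x B ih =>
    have h1 := ih (A ++ [x]) (by simpa using hAB)
    have h2 : (ofWord L hL h).s (L.length * n + B.length) = expSign x.2 := by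
      have h3 : B.length < L.length := by rw [hAB]; simp; omega
      have h4 : (((L.length : ℤ) * n + B.length) % L.length).toNat = B.length := by
        rw [Int.mul_add_emod_self_left, Int.emod_eq_of_lt (by omega) (by omega)]
        simp
      simp only [ofWord, h4]
      congr 2
      rw [hAB]
      simp
    have h5 : (ofWord L hL h).act (x :: B) (L.length * n)
        = (ofWord L hL h).act B (L.length * n)
          + expSign x.2 * (ofWord L hL h).s ((ofWord L hL h).act B (L.length * n)) := rfl
    rw [h5, h1, h2]
    have h6 : expSign x.2 * expSign x.2 = 1 := by rcases expSign_eq x.2 with h | h <;> simp [h]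
    rw [h6, List.length_cons]
    push_cast
    ring

theorem SignPattern.pos_append_singleton (P : SignPattern) (A : List (Fin 2 × Bool))
    (x : Fin 2 × Bool) (i : Fin 2) : P.pos (A ++ [x]) i = P.act (A ++ [x]) (P.start x.1) := by
  rw [P.pos_append_cons _ _ _ _ x.1, act_append]
  rfl

theorem SignPattern.ofWord_turns {L : List (Fin 2 × Bool)} (hL : L ≠ []) (h : L.length % 2 = 0)
    (n : ℕ) : (ofWord L hL h).turns (List.replicate (n + 1) L).flatten = n := by
  have hpos : ∀ n i, (ofWord L hL h).pos (List.replicate (n + 1) L).flatten i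
      = L.length * (n + 1) := by
    intro n
    induction n with
    | zero =>
      intro i
      obtain ⟨A, x, hA⟩ := (List.eq_nil_or_concat' L).resolve_left hL
      have h1 : (ofWord L hL h).start x.1 = 0 := by simp [ofWord, hA]
      have h2 := (ofWord L hL h).pos_append_singleton A x i
      rw [← hA, h1] at h2
      have := ofWord_act hL h 0
      simp_all
    | succ n ih =>
      intro i
      obtain ⟨x, M, hM⟩ : ∃ x M, (List.replicate (n + 1) L).flatten = x :: M := by
        refine List.exists_cons_of_ne_nil ?_
        simp [List.replicate_succ, hL]
      rw [List.replicate_succ, List.flatten_cons, hM, pos_append_cons _ _ _ _ _ x.1, ← hM, ih]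
      have := ofWord_act hL h (n + 1)
      push_cast at *
      exact this
  -- The endpoint N(n + 1) falls short of the translate of the basepoint beyond it, so only n turns
  -- are complete.
  rw [turns_of_ne_nil _ (by simp [List.replicate_succ, hL]) 0, hpos]
  have hN : (0 : ℤ) < L.length := by exact_mod_cast List.length_pos_of_ne_nil hL
  change ((L.length : ℤ) * (n + 1) - 1) / L.length = n
  rw [Int.ediv_eq_iff_of_pos hN]
  constructor <;> linarith

theorem AltFrom.length_emod_iff {L : List (Fin 2 × Bool)} {z : Fin 2 × Bool} {i : Fin 2}
    (h : AltFrom i (L ++ [z])) : L.length % 2 = 1 ↔ z.1 = i := by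
  induction L generalizing i with
  | nil => simpa using h.1.symm
  | cons x L ih =>
    have h1 := ih h.2
    have h2 := h.1
    rw [List.length_cons]
    omega

/-- If all powers of a nontrivial word alternate, then the word has even length and its powers
are given by repetition. -/
theorem even_length_of_pow_mem {w : F2} (hw : w ≠ 1) (h : ∀ n : ℕ, w ^ n ∈ altWords) :
    w.toWord.length % 2 = 0 ∧
      ∀ n : ℕ, (w ^ n).toWord = (List.replicate n w.toWord).flatten := by
  have hL : w.toWord ≠ [] := by simpa using hw
  have h1 : w ∈ altWords := by simpa using h 1
  have h2 : w * w ∈ altWords := by simpa [sq] using h 2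
  obtain ⟨A, B, C, hU, hV, hW, hc⟩ := exists_toWord_mul_eq h1 h1 h2
  have hlen : A.length = B.length := by
    have := congrArg List.length (hU.symm.trans hV)
    simp [FreeGroup.invRev] at this
    omega
  -- If anything cancelled, A or B would be empty, hence both by length, and w would be its own
  -- inverse.
  have hC : C = [] := by
    by_contra hC
    have hB : B = [] := by
      rcases hc with rfl | h | h
      · exact List.length_eq_zero_iff.1 hlen.symm
      · exact h
      · exact absurd h hC
    have hA : A = [] := List.length_eq_zero_iff.1 (by rw [hlen, hB]; rfl)
    rw [hA, hB] at hW
    have h3 : w * w = 1 := FreeGroup.toWord_eq_nil_iff.1 hW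
    exact hw (self_eq_inv.1 (eq_inv_of_mul_eq_one_left h3))
  subst hC
  have hAw : A = w.toWord := by simpa using hU.symm
  have hBw : B = w.toWord := by simpa [FreeGroup.invRev] using hV.symm
  have halt : IsAlt (w.toWord ++ w.toWord) := by
    have h3 : IsAlt (w * w).toWord := h2
    rwa [hW, hAw, hBw] at h3
  constructor
  -- The word w followed by its own first letter alternates and has the same generator at both ends,
  -- so their distance, the length of w, is even.
  · obtain ⟨x, M, hM⟩ := List.exists_cons_of_ne_nil hL
    rw [hM, show x :: M ++ x :: M = (x :: (M ++ [x])) ++ M by simp] at halt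
    have h3 := (isAlt_cons.1 (List.isChain_append.1 halt).1).length_emod_iff.2 rfl
    rw [hM, List.length_cons]
    omega
  · intro n
    have hcyc : FreeGroup.IsCyclicallyReduced w.toWord := by
      refine ⟨FreeGroup.isReduced_toWord, fun a ha b hb hab => ?_⟩
      exact absurd hab ((List.isChain_append.1 halt).2.2 a ha b hb)
    rw [FreeGroup.toWord_pow]
    exact (hcyc.flatten_replicate n).isReduced.reduce_eq

end LetterQM

namespace LetterQM

/-! ### Realizing countable ordered sets on the line -/

/-- An action by monotone maps is an action by order isomorphisms. -/
def orderIsoHom {M α : Type*} [Group M] [Preorder α] (f : M → α → α) (hone : ∀ x, f 1 x = x)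
    (hmul : ∀ m n x, f (m * n) x = f m (f n x)) (hmono : ∀ m, Monotone (f m)) :
    M →* (α ≃o α) where
  toFun m :=
    { toFun := f m
      invFun := f m⁻¹
      left_inv := fun x => by rw [← hmul, inv_mul_cancel, hone]
      right_inv := fun x => by rw [← hmul, mul_inv_cancel, hone]
      map_rel_iff' := fun {x y} => by
        refine ⟨fun h => ?_, fun h => hmono m h⟩
        have h' := hmono m⁻¹ h
        simpa only [Equiv.coe_fn_mk, ← hmul, inv_mul_cancel, hone] using h' }
  map_one' := by ext x; exact hone x
  map_mul' m n := by ext x; exact hmul m n x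

/-- A group acting on a countable total preorder also acts on the rationals, so that the preorder
embeds equivariantly. -/
theorem exists_rational_realization {M X : Type*} [Group M] [Preorder X] [Countable X] [Nonempty X]
    [NoMinOrder X] [NoMaxOrder X] (htot : ∀ x y : X, x ≤ y ∨ y ≤ x) (A : M →* (X ≃o X)) :
    ∃ (e : X → ℚ) (B : M →* (ℚ ≃o ℚ)), (∀ x y, e x ≤ e y ↔ x ≤ y) ∧
      (∀ m x, B m (e x) = e (A m x)) ∧ ∀ q, (∃ x, e x < q) ∧ ∃ x, q < e x := by
  classical
  have : @Std.Total X (· ≤ ·) := ⟨htot⟩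
  let Q := Antisymmetrization X (· ≤ ·)
  have : Countable Q := inferInstanceAs (Countable (Quotient _))
  let mkQ : X → Q := toAntisymmetrization (· ≤ ·)
  have : Countable (Q ×ₗ ℚ) := inferInstanceAs (Countable (Q × ℚ))
  have : Nonempty Q := ⟨mkQ (Classical.arbitrary X)⟩
  have : Nonempty (Q ×ₗ ℚ) := inferInstanceAs (Nonempty (Q × ℚ))
  -- Replacing each class by a copy of ℚ makes the order dense and without endpoints, so Cantor's
  -- theorem applies; the group acts on the first coordinate only.
  obtain ⟨t⟩ := Order.iso_of_countable_dense (Q ×ₗ ℚ) ℚ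
  let A₁ : M →* (Q ≃o Q) := orderIsoHom
    (fun m => ((A m : X ≃o X) : X →o X).antisymmetrization)
    (fun x => by
      induction x using Antisymmetrization.ind with | _ x
      rw [OrderHom.antisymmetrization_apply_mk, map_one]
      rfl)
    (fun m n x => by
      induction x using Antisymmetrization.ind with | _ x
      rw [OrderHom.antisymmetrization_apply_mk, OrderHom.antisymmetrization_apply_mk,
        OrderHom.antisymmetrization_apply_mk, map_mul]
      rfl)
    (fun m => OrderHom.monotone _)
  have hA₁ : ∀ m x, A₁ m (mkQ x) = mkQ (A m x) := fun m x => rfl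
  let B : M →* (ℚ ≃o ℚ) := orderIsoHom
    (fun m q => t (toLex (A₁ m (ofLex (t.symm q)).1, (ofLex (t.symm q)).2)))
    (fun q => by simp)
    (fun m n q => by simp [RelIso.mul_apply])
    (fun m p q hpq => by
      rw [t.le_iff_le]
      have h : t.symm p ≤ t.symm q := t.symm.monotone hpq
      rw [Prod.Lex.le_iff] at h ⊢
      simpa using h)
  refine ⟨fun x => t (toLex (mkQ x, 0)), B, fun x y => ?_, fun m x => ?_, fun q => ⟨?_, ?_⟩⟩
  · rw [t.le_iff_le, Prod.Lex.toLex_le_toLex']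
    simp only [le_refl, implies_true, and_true]
    exact Iff.rfl
  · change t (toLex (A₁ m (ofLex (t.symm (t (toLex (mkQ x, 0))))).1, _)) = _
    simp [hA₁]
  · obtain ⟨x, hx⟩ : ∃ x, mkQ x = (ofLex (t.symm q)).1 := Quotient.exists_rep _
    obtain ⟨y, hy⟩ := exists_lt x
    refine ⟨y, ?_⟩
    rw [← t.lt_symm_apply, Prod.Lex.lt_iff]
    left
    rw [← hx]
    exact hy
  · obtain ⟨x, hx⟩ : ∃ x, mkQ x = (ofLex (t.symm q)).1 := Quotient.exists_rep _
    obtain ⟨y, hy⟩ := exists_gt x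
    refine ⟨y, ?_⟩
    rw [← t.symm_apply_lt, Prod.Lex.lt_iff]
    left
    rw [← hx]
    exact hy

/-- The monotone extension of an order automorphism of the rationals to the reals. -/
noncomputable def extendRat (a : ℚ ≃o ℚ) (x : ℝ) : ℝ :=
  sSup ((fun q : ℚ => (a q : ℝ)) '' {q | (q : ℝ) ≤ x})

theorem extendRat_bddAbove (a : ℚ ≃o ℚ) (x : ℝ) :
    BddAbove ((fun q : ℚ => (a q : ℝ)) '' {q | (q : ℝ) ≤ x}) := by
  obtain ⟨r, hr⟩ := exists_rat_gt x
  refine ⟨a r, ?_⟩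
  rintro _ ⟨q, hq, rfl⟩
  have : q ≤ r := by exact_mod_cast (le_trans hq hr.le)
  exact Rat.cast_le.2 (a.monotone this)

theorem extendRat_monotone (a : ℚ ≃o ℚ) : Monotone (extendRat a) := by
  intro x y hxy
  obtain ⟨r, hr⟩ := exists_rat_lt x
  refine csSup_le_csSup (extendRat_bddAbove a y) ⟨_, r, hr.le, rfl⟩ ?_
  exact Set.image_mono fun q hq => le_trans hq hxy

@[simp] theorem extendRat_ratCast (a : ℚ ≃o ℚ) (q : ℚ) : extendRat a q = a q := by
  refine le_antisymm (csSup_le ⟨_, q, le_refl (q : ℝ), rfl⟩ ?_)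
    (le_csSup (extendRat_bddAbove a q) ⟨q, le_refl (q : ℝ), rfl⟩)
  rintro _ ⟨p, hp, rfl⟩
  have : p ≤ q := by exact_mod_cast hp
  exact Rat.cast_le.2 (a.monotone this)

theorem eq_self_of_monotone_of_ratCast {f : ℝ → ℝ} (hf : Monotone f)
    (hq : ∀ q : ℚ, f q = q) (x : ℝ) : f x = x := by
  refine le_antisymm ?_ ?_
  · by_contra! h
    obtain ⟨q, h1, h2⟩ := exists_rat_btwn h
    have := hf h1.le
    rw [hq] at this
    linarith
  · by_contra! h
    obtain ⟨q, h1, h2⟩ := exists_rat_btwn h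
    have := hf h2.le
    rw [hq] at this
    linarith

/-- A monotone map fixing every rational is the identity, so the identity need only be checked on ℚ
and no continuity is used. -/
theorem extendRat_mul (a b : ℚ ≃o ℚ) (x : ℝ) :
    extendRat (a * b) x = extendRat a (extendRat b x) := by
  have h1 : extendRat (a * b)⁻¹ (extendRat a (extendRat b x)) = x :=
    eq_self_of_monotone_of_ratCast (f := fun x => extendRat (a * b)⁻¹ (extendRat a (extendRat b x)))
      (((extendRat_monotone _).comp (extendRat_monotone a)).comp (extendRat_monotone b))
      (fun q => by
        simp only [extendRat_ratCast, ← RelIso.mul_apply, inv_mul_cancel]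
        simp) x
  have h2 : extendRat (a * b) (extendRat (a * b)⁻¹ (extendRat a (extendRat b x)))
      = extendRat a (extendRat b x) :=
    eq_self_of_monotone_of_ratCast (f := fun x => extendRat (a * b) (extendRat (a * b)⁻¹ x))
      ((extendRat_monotone _).comp (extendRat_monotone _))
      (fun q => by
        simp only [extendRat_ratCast, RelIso.apply_inv_self]) _
  rw [← h2, h1]

/-- Order automorphisms of the rationals extend to the reals. -/
noncomputable def extendRatHom : (ℚ ≃o ℚ) →* (ℝ ≃o ℝ) :=
  orderIsoHom extendRat
    (eq_self_of_monotone_of_ratCast (extendRat_monotone 1) fun q => by simp)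
    extendRat_mul extendRat_monotone

@[simp] theorem extendRatHom_ratCast (a : ℚ ≃o ℚ) (q : ℚ) : extendRatHom a (q : ℝ) = a q :=
  extendRat_ratCast a q

/-- An automorphism of the ordered line all of whose orbits are unbounded in both directions is
conjugate to the translation by one. -/
theorem exists_conj_translation (T : ℝ ≃o ℝ) (x₀ : ℝ) (hx₀ : x₀ < T x₀)
    (hT : ∀ x, (∃ n : ℤ, (T ^ n) x₀ < x) ∧ ∃ n : ℤ, x < (T ^ n) x₀) :
    ∃ E : ℝ ≃o ℝ, E 0 = x₀ ∧ ∀ s, E (s + 1) = T (E s) := by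
  have hmono : StrictMono fun n : ℤ => (T ^ n) x₀ := by
    refine strictMono_int_of_lt_succ fun n => ?_
    rw [zpow_add_one, RelIso.mul_apply]
    exact (T ^ n).strictMono hx₀
  -- Affine on the fundamental domain from x₀ to T x₀, and extended equivariantly.
  let E : ℝ → ℝ := fun s => (T ^ ⌊s⌋) (x₀ + Int.fract s * (T x₀ - x₀))
  have hlow : ∀ s, (T ^ ⌊s⌋) x₀ ≤ E s := fun s => (T ^ ⌊s⌋).monotone (by
    nlinarith [Int.fract_nonneg s])
  have hup : ∀ s, E s < (T ^ (⌊s⌋ + 1)) x₀ := fun s => by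
    rw [zpow_add_one, RelIso.mul_apply]
    exact (T ^ ⌊s⌋).strictMono (by nlinarith [Int.fract_lt_one s])
  have hE : StrictMono E := by
    intro s s' hs
    rcases (Int.floor_mono hs.le).lt_or_eq with h | h
    · exact (hup s).trans_le ((hmono.monotone (Int.add_one_le_iff.2 h)).trans (hlow s'))
    · have h1 : Int.fract s < Int.fract s' := by
        rw [Int.fract, Int.fract, h]
        linarith
      simp only [E, h]
      exact (T ^ ⌊s'⌋).strictMono (by nlinarith)
  have hsurj : Function.Surjective E := by
    intro x
    obtain ⟨⟨a, ha⟩, b, hb⟩ := hT x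
    obtain ⟨n, hn, hn'⟩ := Int.exists_greatest_of_bdd (P := fun n : ℤ => (T ^ n) x₀ ≤ x)
      ⟨b, fun z hz => (hmono.lt_iff_lt.1 (lt_of_le_of_lt hz hb)).le⟩ ⟨a, ha.le⟩
    have hn1 : x < (T ^ (n + 1)) x₀ := by
      by_contra! h
      linarith [hn' _ h]
    rw [zpow_add_one, RelIso.mul_apply] at hn1
    have h1 : x₀ ≤ (T ^ n)⁻¹ x := by
      rw [← (T ^ n).le_iff_le, RelIso.apply_inv_self]
      exact hn
    have h2 : (T ^ n)⁻¹ x < T x₀ := by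
      rw [← (T ^ n).lt_iff_lt, RelIso.apply_inv_self]
      exact hn1
    have hpos : 0 < T x₀ - x₀ := by linarith
    set r := ((T ^ n)⁻¹ x - x₀) / (T x₀ - x₀)
    have hr0 : 0 ≤ r := div_nonneg (by linarith) hpos.le
    have hr1 : r < 1 := by
      rw [div_lt_one hpos]
      linarith
    refine ⟨n + r, ?_⟩
    have h3 : ⌊(n : ℝ) + r⌋ = n := by
      rw [Int.floor_intCast_add, Int.floor_eq_zero_iff.2 ⟨hr0, hr1⟩, add_zero]
    have h4 : Int.fract ((n : ℝ) + r) = r := by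
      rw [Int.fract, h3]
      ring
    simp only [E, h3, h4]
    rw [show x₀ + r * (T x₀ - x₀) = (T ^ n)⁻¹ x by
      simp only [r]
      field_simp
      ring, RelIso.apply_inv_self]
  refine ⟨hE.orderIsoOfSurjective E hsurj, ?_, fun s => ?_⟩
  · simp [E]
  · change E (s + 1) = T (E s)
    simp only [E, Int.floor_add_one, Int.fract_add_one]
    rw [zpow_add_one, ← RelIso.mul_apply, (Commute.refl T).zpow_left ⌊s⌋ |>.eq]

end LetterQM

namespace LetterQM

/-! ### Circle actions from quasimorphisms with unit coboundary -/

/-- The lifted orbit of the basepoint for the circle action defined by `F`. -/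
structure LiftedOrbit {G : Type*} [Group G] {F : G → ℤ} (_ : IsUnitQuasimorphism F) where
  fst : G
  snd : ℤ

namespace IsUnitQuasimorphism

variable {G : Type*} [Group G] {F : G → ℤ} (hF : IsUnitQuasimorphism F)

/-- The pair (g, k) stands for the point g·p + k over a basepoint p; thus F(g) is the least l with p
≤ g·p + l. Transitivity is subadditivity of F, and totality comes from the opposite inequality. -/
instance : Preorder (LiftedOrbit hF) where
  le x y := F (x.1⁻¹ * y.1) ≤ y.2 - x.2
  le_refl x := by simp [hF.map_one]
  le_trans x y z hxy hyz := by
    have h := hF.map_mul_le (x.1⁻¹ * y.1) (y.1⁻¹ * z.1)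
    rw [show x.1⁻¹ * y.1 * (y.1⁻¹ * z.1) = x.1⁻¹ * z.1 by group] at h
    change F (x.1⁻¹ * z.1) ≤ z.2 - x.2
    linarith

theorem liftedOrbit_le_iff (x y : LiftedOrbit hF) : x ≤ y ↔ F (x.1⁻¹ * y.1) ≤ y.2 - x.2 := Iff.rfl

theorem liftedOrbit_total (x y : LiftedOrbit hF) : x ≤ y ∨ y ≤ x := by
  rw [liftedOrbit_le_iff, liftedOrbit_le_iff]
  have h := hF.le_map_mul (x.1⁻¹ * y.1) (y.1⁻¹ * x.1)
  rw [show x.1⁻¹ * y.1 * (y.1⁻¹ * x.1) = 1 by group, hF.map_one] at h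
  omega

theorem liftedOrbit_lt_shift (x : LiftedOrbit hF) {k : ℤ} (hk : x.2 < k) :
    x < ⟨x.1, k⟩ := by
  rw [lt_iff_le_not_ge, liftedOrbit_le_iff, liftedOrbit_le_iff]
  simp only [inv_mul_cancel, hF.map_one]
  constructor <;> omega

instance : NoMaxOrder (LiftedOrbit hF) where
  exists_gt x := ⟨_, hF.liftedOrbit_lt_shift x (lt_add_one x.2)⟩

instance : NoMinOrder (LiftedOrbit hF) where
  exists_lt x := ⟨⟨x.1, x.2 - 1⟩, hF.liftedOrbit_lt_shift ⟨x.1, x.2 - 1⟩ (sub_one_lt x.2)⟩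

instance : Nonempty (LiftedOrbit hF) := ⟨⟨1, 0⟩⟩

instance [Countable G] : Countable (LiftedOrbit hF) :=
  Function.Injective.countable (f := fun x : LiftedOrbit hF => (x.1, x.2)) fun x y h => by
    cases x
    cases y
    simpa using h

/-- The action of `G × ℤ` on the lifted orbit. -/
def liftedAction : G × Multiplicative ℤ →* (LiftedOrbit hF ≃o LiftedOrbit hF) :=
  orderIsoHom (fun m x => ⟨m.1 * x.1, m.2.toAdd + x.2⟩)
    (fun x => by simp)
    (fun m n x => by simp [mul_assoc, add_assoc])
    (fun m x y h => by
      rw [liftedOrbit_le_iff] at h ⊢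
      dsimp only
      rw [show (m.1 * x.1)⁻¹ * (m.1 * y.1) = x.1⁻¹ * y.1 by group]
      linarith)

include hF in
/-- A quasimorphism with unit coboundary on a countable group is, up to sign and a bounded error,
the displacement of the origin for an action on the line commuting with integer translations. -/
theorem exists_line_action [Countable G] :
    ∃ Ψ : G →* homeoZ, ∀ g, 0 ≤ (Ψ g : ℝ ≃ₜ ℝ) 0 + F g ∧ (Ψ g : ℝ ≃ₜ ℝ) 0 + F g ≤ 1 := by
  obtain ⟨e, B, he, hB, hcof⟩ := exists_rational_realization hF.liftedOrbit_total hF.liftedAction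
  let R : G × Multiplicative ℤ →* (ℝ ≃o ℝ) := extendRatHom.comp B
  let pt : G → ℤ → LiftedOrbit hF := fun g k => ⟨g, k⟩
  have hRmul : ∀ m n x, R m (R n x) = R (m * n) x := fun m n x => by
    rw [map_mul, RelIso.mul_apply]
  have hR : ∀ (g : G) (n : ℤ) h l, R (g, Multiplicative.ofAdd n) (e (pt h l) : ℝ)
      = e (pt (g * h) (n + l)) := fun g n h l => by
    change extendRatHom (B _) _ = _
    rw [extendRatHom_ratCast, hB]
    rfl
  have hle : ∀ g k h l, (e (pt g k) : ℝ) ≤ e (pt h l) ↔ F (g⁻¹ * h) ≤ l - k := fun g k h l => by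
    rw [Rat.cast_le, he]
    exact Iff.rfl
  let T : ℝ ≃o ℝ := R (1, Multiplicative.ofAdd 1)
  have hT : ∀ n : ℤ, T ^ n = R (1, Multiplicative.ofAdd n) := fun n => by
    rw [← map_zpow, Prod.pow_mk, one_zpow, ← ofAdd_zsmul]
    simp
  have hTpt : ∀ (n : ℤ) h l, (T ^ n) (e (pt h l) : ℝ) = e (pt h (n + l)) := fun n h l => by
    rw [hT, hR, one_mul]
  have hT1 : T (e (pt 1 0)) = e (pt 1 1) := by simpa using hTpt 1 1 0
  obtain ⟨E, hE0, hE⟩ := exists_conj_translation T (e (pt 1 0))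
    (by
      rw [hT1, ← not_le, hle]
      simp [hF.map_one])
    (fun x => by
      constructor
      · obtain ⟨q, hq⟩ := exists_rat_lt x
        obtain ⟨⟨y, hy⟩, -⟩ := hcof q
        -- This is the largest k with (1, k) below y; the witness for the upper bound is the least k
        -- with (1, k) above y.
        refine ⟨y.2 - F y.1, ?_⟩
        have h1 : (e (pt 1 (y.2 - F y.1)) : ℝ) ≤ e (pt y.1 y.2) := by
          rw [hle]
          simp
        have h2 : (e (pt y.1 y.2) : ℝ) < q := by exact_mod_cast hy
        rw [hTpt, add_zero]
        linarith
      · obtain ⟨q, hq⟩ := exists_rat_gt x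
        obtain ⟨-, ⟨y, hy⟩⟩ := hcof q
        refine ⟨y.2 + F y.1⁻¹, ?_⟩
        have h1 : (e (pt y.1 y.2) : ℝ) ≤ e (pt 1 (y.2 + F y.1⁻¹)) := by
          rw [hle]
          simp
        have h2 : (q : ℝ) < e (pt y.1 y.2) := by exact_mod_cast hy
        rw [hTpt, add_zero]
        linarith)
  have hEnat : ∀ (n : ℕ) s, E (s + n) = (T ^ n) (E s) := by
    intro n
    induction n with
    | zero => simp
    | succ n ih =>
      intro s
      rw [Nat.cast_add_one, ← add_assoc, hE, ih, ← RelIso.mul_apply, ← pow_succ']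
  have hEint : ∀ (n : ℤ) s, E (s + n) = (T ^ n) (E s) := by
    intro n s
    obtain ⟨k, rfl | rfl⟩ := n.eq_nat_or_neg
    · simpa using hEnat k s
    · have h := hEnat k (s + ((-(k : ℤ) : ℤ) : ℝ))
      rw [show s + ((-(k : ℤ) : ℤ) : ℝ) + (k : ℝ) = s by push_cast; ring] at h
      rw [h, ← RelIso.mul_apply, zpow_neg, zpow_natCast, inv_mul_cancel]
      rfl
  let ψ : G → (ℝ ≃o ℝ) := fun g => E⁻¹ * R (g, 1) * E
  have hEψ : ∀ g x, E (ψ g x) = R (g, 1) (E x) := fun g x => by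
    simp only [ψ, RelIso.mul_apply, RelIso.apply_inv_self]
  have hψmul : ∀ g h x, ψ (g * h) x = ψ g (ψ h x) := fun g h x => by
    apply E.injective
    rw [hEψ, hEψ, hEψ, hRmul, Prod.mk_mul_mk, one_mul]
  have hψone : ∀ x, ψ 1 x = x := fun x => by
    apply E.injective
    rw [hEψ, show ((1, 1) : G × Multiplicative ℤ) = 1 from rfl, MonoidHom.map_one]
    rfl
  have hψint : ∀ g (n : ℤ) x, ψ g (x + n) = ψ g x + n := fun g n x => by
    apply E.injective
    rw [hEψ, hEint, hEint, hEψ, hT, hRmul, hRmul, Prod.mk_mul_mk, Prod.mk_mul_mk]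
    simp
  refine ⟨{ toFun := fun g => ⟨(ψ g).toHomeomorph, (ψ g).strictMono, hψint g⟩
            map_one' := Subtype.ext (Homeomorph.ext hψone)
            map_mul' := fun g h => Subtype.ext (Homeomorph.ext (hψmul g h)) }, fun g => ?_⟩
  change 0 ≤ ψ g 0 + F g ∧ ψ g 0 + F g ≤ 1
  -- In the coordinate E the shifted image of the origin is the point (g, F g), which lies between
  -- (1, 0) and (1, 1).
  have hEg : E (ψ g 0 + F g) = e (pt g (F g)) := by
    rw [hEint, hEψ, hE0]
    have h := hR g 0 1 0
    rw [ofAdd_zero, mul_one, add_zero] at h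
    rw [h, hTpt, add_zero]
  constructor
  · rw [← E.le_iff_le, hEg, hE0, hle]
    simp
  · have h1 : E 1 = e (pt 1 1) := by
      have h := hE 0
      rwa [zero_add, hE0, hT1] at h
    rw [← E.le_iff_le, hEg, h1, hle, mul_one]
    have h := hF.le_map_mul g g⁻¹
    rw [mul_inv_cancel, hF.map_one] at h
    linarith

end IsUnitQuasimorphism

/-! ### Passage to the circle and the Euler class -/

/-- The map of the circle induced by a homeomorphism of the line commuting with translations. -/
def circleMap (f : homeoZ) : UnitAddCircle → UnitAddCircle :=
  Quotient.map' (f : ℝ ≃ₜ ℝ) fun x y hxy => by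
    obtain ⟨n, rfl⟩ := coe_eq_coe_iff.1 (Quotient.sound' hxy)
    exact Quotient.exact' (coe_eq_coe_iff.2 ⟨n, f.2.2 n y⟩)

theorem circleMap_coe (f : homeoZ) (x : ℝ) :
    circleMap f (x : UnitAddCircle) = (((f : ℝ ≃ₜ ℝ) x : ℝ) : UnitAddCircle) := rfl

theorem continuous_circleMap (f : homeoZ) : Continuous (circleMap f) :=
  (f : ℝ ≃ₜ ℝ).continuous.quotient_map' _

theorem circleMap_mul (f f' : homeoZ) (x : UnitAddCircle) :
    circleMap (f * f') x = circleMap f (circleMap f' x) := by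
  induction x using QuotientAddGroup.induction_on with | _ x
  rfl

theorem circleMap_one (x : UnitAddCircle) : circleMap 1 x = x := by
  induction x using QuotientAddGroup.induction_on with | _ x
  rfl

/-- The homomorphism from homeomorphisms of the line commuting with integer translations to
homeomorphisms of the circle. -/
def toHomeoCircle : homeoZ →* homeoCircle where
  toFun f :=
    ⟨{ toFun := circleMap f
       invFun := circleMap f⁻¹
       left_inv := fun x => by rw [← circleMap_mul, inv_mul_cancel, circleMap_one]
       right_inv := fun x => by rw [← circleMap_mul, mul_inv_cancel, circleMap_one]
       continuous_toFun := continuous_circleMap f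
       continuous_invFun := continuous_circleMap f⁻¹ }, f, f.2, circleMap_coe f⟩
  map_one' := Subtype.ext (Homeomorph.ext circleMap_one)
  map_mul' f f' := Subtype.ext (Homeomorph.ext (circleMap_mul f f'))

theorem lift_toHomeoCircle (f : homeoZ) (x : ℝ) :
    lift (toHomeoCircle f) x = (f : ℝ ≃ₜ ℝ) x - ⌊(f : ℝ ≃ₜ ℝ) 0⌋ := by
  obtain ⟨h1, h2, h3⟩ := lift_spec (toHomeoCircle f)
  have hf : IsLift (f : ℝ ≃ₜ ℝ) (toHomeoCircle f) := circleMap_coe f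
  have hi : IsLift ((f : ℝ ≃ₜ ℝ)⁻¹ * lift (toHomeoCircle f)) 1 := by simpa using hf.inv.mul h2
  obtain ⟨n, hn⟩ := exists_translation (homeoZ.mul_mem (homeoZ.inv_mem f.2) h1) hi
  have hn' : ∀ x, lift (toHomeoCircle f) x = (f : ℝ ≃ₜ ℝ) x + n := fun x => by
    rw [← f.2.2 n x, ← hn x]
    simp
  have h4 : n = -⌊(f : ℝ ≃ₜ ℝ) 0⌋ := by
    have h5 : ⌊(f : ℝ ≃ₜ ℝ) 0 + n⌋ = 0 := by
      rw [← hn', Int.floor_eq_zero_iff]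
      exact h3
    rw [Int.floor_add_intCast] at h5
    omega
  rw [hn', h4]
  push_cast
  ring

/-- When the lifts themselves compose, the Euler cocycle is the coboundary of the integer
corrections -⌊f 0⌋ that normalize them. -/
theorem eulerFun_toHomeoCircle (f f' : homeoZ) :
    eulerFun (toHomeoCircle f, toHomeoCircle f')
      = -⌊(f : ℝ ≃ₜ ℝ) 0⌋ - ⌊(f' : ℝ ≃ₜ ℝ) 0⌋ + ⌊((f * f' : homeoZ) : ℝ ≃ₜ ℝ) 0⌋ := by
  have h := eulerFun_spec (toHomeoCircle f) (toHomeoCircle f') 0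
  rw [← map_mul, lift_toHomeoCircle, lift_toHomeoCircle, lift_toHomeoCircle] at h
  have h1 := f.2.2 (-⌊(f' : ℝ ≃ₜ ℝ) 0⌋) ((f' : ℝ ≃ₜ ℝ) 0)
  rw [Int.cast_neg, ← sub_eq_add_neg] at h1
  have h2 : ((f * f' : homeoZ) : ℝ ≃ₜ ℝ) 0 = (f : ℝ ≃ₜ ℝ) ((f' : ℝ ≃ₜ ℝ) 0) := rfl
  rw [h1] at h
  rw [← h2] at h
  have h3 : (eulerFun (toHomeoCircle f, toHomeoCircle f') : ℝ)
      = ((-⌊(f : ℝ ≃ₜ ℝ) 0⌋ - ⌊(f' : ℝ ≃ₜ ℝ) 0⌋ + ⌊((f * f' : homeoZ) : ℝ ≃ₜ ℝ) 0⌋ : ℤ) : ℝ) := by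
    rw [Int.cast_add, Int.cast_sub, Int.cast_neg]
    linarith
  exact_mod_cast h3

/-- Ghys' theorem for a coboundary with values in `{0, 1}`: its class is the real bounded Euler
class of an action on the circle. -/
theorem IsUnitQuasimorphism.exists_circle_action {G : Type*} [Group G] [Countable G] {F : G → ℤ}
    (hF : IsUnitQuasimorphism F) (hφ : IsQuasimorphism (homogenization F)) :
    ∃ ρ : G →* homeoCircle, hφ.boundedClass = H2b.pullback ρ realBoundedEulerClass := by
  obtain ⟨Ψ, hΨ⟩ := hF.exists_line_action
  refine ⟨toHomeoCircle.comp Ψ, ?_⟩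
  let m : G → ℤ := fun g => -⌊(Ψ g : ℝ ≃ₜ ℝ) 0⌋
  change QuotientAddGroup.mk _ = QuotientAddGroup.mk _
  rw [QuotientAddGroup.eq, AddSubgroup.mem_addSubgroupOf]
  -- The correction `m g` is within 1 of `F g`, which exceeds the homogenization by at most 1; this
  -- gives the bound 2.
  refine ⟨fun g => m g - homogenization F g, ⟨2, fun g => ?_⟩, ?_⟩
  · have h1 := hF.homogenization_le g
    have h2 := hF.le_homogenization g
    have h3 := hΨ g
    have h4 := Int.floor_le ((Ψ g : ℝ ≃ₜ ℝ) 0)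
    have h5 := Int.lt_floor_add_one ((Ψ g : ℝ ≃ₜ ℝ) 0)
    rw [Real.norm_eq_abs, abs_le]
    simp only [m, Int.cast_neg]
    constructor <;> linarith
  · ext ⟨g, h⟩
    have h1 := eulerFun_toHomeoCircle (Ψ g) (Ψ h)
    rw [← map_mul] at h1
    change ((m h : ℝ) - homogenization F h) - ((m (g * h) : ℝ) - homogenization F (g * h))
      + ((m g : ℝ) - homogenization F g)
      = -(homogenization F h - homogenization F (g * h) + homogenization F g)
        + ((eulerFun (toHomeoCircle (Ψ g), toHomeoCircle (Ψ h)) : ℤ) : ℝ)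
    rw [h1]
    simp only [m]
    push_cast
    ring

end LetterQM

/-! ### Proof of the theorem -/

open LetterQM in
theorem theorem4p6 {G : Type*} [Group G] (g₀ : G) (Φ : G → LetterQM.F2)
    (hΦ : LetterQM.IsLetterQuasimorphism Φ) (hne : Φ g₀ ≠ 1)
    (hpow : ∀ n : ℕ, Φ (g₀ ^ n) = Φ g₀ ^ n) :
    (∃ (φ : G → ℝ) (hφ : LetterQM.IsQuasimorphism φ),
      LetterQM.IsHomogeneous φ ∧ LetterQM.defect φ ≤ 1 ∧ 1 ≤ φ g₀ ∧
      (Countable G → ∃ ρ : G →* LetterQM.homeoCircle,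
        hφ.boundedClass = LetterQM.H2b.pullback ρ LetterQM.realBoundedEulerClass)) ∧
    (g₀ ∈ commutator G → 1 / 2 ≤ LetterQM.scl g₀) := by
  obtain ⟨heven, hword⟩ := even_length_of_pow_mem hne fun n => hpow n ▸ hΦ.mem_altWords (g₀ ^ n)
  have hL : (Φ g₀).toWord ≠ [] := by simpa using hne
  -- The circle is adapted to Φ(g₀), so that this particular word travels forward at every letter.
  let P := SignPattern.ofWord _ hL heven
  have hF := P.isUnitQuasimorphism hΦ
  set F : G → ℤ := fun g => -P.turns (Φ g⁻¹).toWord with hFdef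
  have hFpow : ∀ n : ℕ, F (g₀ ^ (n + 1)) = n + 1 := fun n => by
    have h1 : P.turns (Φ (g₀ ^ (n + 1))).toWord = n := by
      rw [hpow, hword]
      exact SignPattern.ofWord_turns hL heven n
    have hne' : (Φ (g₀ ^ (n + 1))).toWord ≠ [] := by
      rw [hpow, hword]
      simp [List.replicate_succ, hL]
    have h2 := P.turns_invRev (hΦ.mem_altWords (g₀ ^ (n + 1))) hne'
    simp only [hFdef]
    rw [hΦ.map_inv, FreeGroup.toWord_inv, h2, h1]
    ring
  have hone : 1 ≤ homogenization F g₀ := by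
    refine le_of_forall_nat_mul_le (C := 1) fun n => ?_
    have h1 := hF.le_homogenization (g₀ ^ n)
    rw [hF.homogenization_pow] at h1
    have h2 : F (g₀ ^ n) = n := by
      cases n with
      | zero => simpa using hF.map_one
      | succ n => simpa using hFpow n
    rw [h2] at h1
    push_cast at h1
    linarith
  refine ⟨⟨homogenization F, hF.isQuasimorphism_homogenization, hF.isHomogeneous_homogenization,
    hF.defect_homogenization_le, hone, fun _ => hF.exists_circle_action _⟩, fun hg => ?_⟩
  have h := hF.isHomogeneous_homogenization.le_scl hF.abs_homogenization_mul_sub_le hg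
  linarith
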